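/- Let $p,q$ be odd primes with $\max\left\{p,\frac{p(p-20)}{16}\right\}>q$, and suppose that $q\nmid h_p^-$, where $h_p^-=h_p/h_p^+$ is the relative class number of the $p$-th cyclotomic field, that is, $h_p$ is the class number of $\mathbb{Q}(\zeta_p)$ and $h_p^+$ that of its maximal real subfield $\mathbb{Q}(\zeta_p+\zeta_p^{-1})$. Let $x,y,z\in\mathbb{Z}$ satisfy $\gcd(x,y,z)=1$ and $$x^p+y^p=z^q .$$ Then, possibly after interchanging $x$ and $y$, $$x+f\cdot y\equiv 0 \bmod q^2\qquad\text{for some } f\in\{-1,0,1\}.$$ In other words, $q^2$ divides at least one of the integers $x$, $y$, $x+y$, $x-y$. -/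

import Mathlib

/-- The relative class number `h⁻ = h / h⁺` of a number field `K` : the quotient of the class
number of `K` by the class number of its maximal real subfield. If `K` is a CM field (for
instance the `p`-th cyclotomic field with `p` an odd prime) then `h⁺` divides `h`, so that the
division of natural numbers is exact. -/
noncomputable def relativeClassNumber (K : Type*) [Field K] [NumberField K] : ℕ :=
  NumberField.classNumber K / NumberField.classNumber (NumberField.maximalRealSubfield K)

/-!
Write `ζ` for a primitive `p`-th root of unity, `σ` for complex conjugation and `A = x + ζ y`.

Suppose first that `p ≠ q`. The ideal of `A` is a `q`-th power `𝔞 ^ q`, up to a factor `1 - ζ` when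
`p` divides `z` (`exists_span_eq_pow`). The class group of the maximal real subfield embeds into
that of the cyclotomic field (`extendedHom_injective`), with index the relative class number. As `q`
does not divide this index, the class of `𝔞` comes from the real subfield, so that `A / σ A` is the
`q`-th power of some `σ a / a`, up to a root of unity, which is itself a `q`-th power
(`exists_add_zeta_mul_pow_eq`, `exists_neg_zeta_pow_eq_pow`). Comparing with the Frobenius
automorphism at `q` gives a congruence modulo `q ^ 2`. After division by `q` it says that a
combination `∑ e j (ζ ^ j - ζ ^ (-j))` over `1 ≤ j ≤ q` is divisible by `q`, where
`q e j = q.choose j (x ^ j y ^ (q + 1 - j) - x ^ (q + 1 - j) y ^ j)`. Linear independence of the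
powers of `ζ` turns this into relations modulo `q` between the `e j` with `j ≡ m` and those with
`j ≡ -m` modulo `p` (`class_sums_modEq_neg`).

When `q` divides neither `x` nor `y`, put `τ = -x / y` modulo `q`; then `j e j` is proportional to
`τ ^ j - τ ^ (2 - j)`. While `m` runs through a window without any integer congruent to `± q` modulo
`p`, the relations say that the quotient of two fixed rational functions of `m`, with simple poles
at the same few multiples of `p`, takes the values `τ ^ (2 m)`. Comparing consecutive values
shows that `τ ^ 2 = 1` once the window has twice as many elements as there are poles
(`sq_eq_one_of_window`), and the bound relating
`p` and `q` provides such a window, apart from two small cases (`sq_eq_one_of_class_sums`). Hence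
`x ≡ ± y` modulo `q`. In every case the relation for the class of `q` now reduces to
`x ^ q y ≡ x y ^ q` modulo `q ^ 2`, and lifting the exponent concludes
(`sq_dvd_of_sq_dvd_pow_mul_sub`).

If `p = q`, the bound forces `p ≥ 5` and the equation is Fermat's. When `p` divides `x`, `y` or `z`,
elementary factorizations give the claim. Otherwise Kummer's argument gives `x ≡ y` and, after
rearranging the equation, `x ≡ -z` modulo `p`, whence `3 x ≡ 0`, which is impossible.
-/

/-! ### Exponentials and rational functions on an interval -/

open Polynomial in
/-- On a long interval, a nontrivial exponential `m ↦ τ ^ (2 * m)` does not agree with the quotient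
`g / f` of two rational functions with the same few simple poles. For `f = ∑ u n / (X - a n)` and
`g = ∑ v n / (X - a n)`, clearing denominators in `f (m) g (m + 1) = τ ^ 2 g (m) f (m + 1)` gives a
polynomial of degree less than its number of zeros, and its leading coefficient contains the factor
`1 - τ ^ 2`. -/
theorem sq_eq_one_of_forall_sum_div_eq_zero {F ι : Type*} [Field F] (S : Finset ι)
    (hS : S.Nonempty) (a u v : ι → F) (ha : Set.InjOn a S) (hu : ∀ n ∈ S, u n ≠ 0)
    (hv : ∀ n ∈ S, v n ≠ 0) (τ : F) (hτ : τ ≠ 0) (m₀ : ℤ) (L : ℕ) (hL : 2 * S.card ≤ L)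
    (hinj : ∀ i < L, ∀ j < L, ((m₀ + i : ℤ) : F) = ((m₀ + j : ℤ) : F) → i = j)
    (hpole : ∀ i < L, ∀ n ∈ S, ((m₀ + i : ℤ) : F) ≠ a n)
    (h : ∀ i < L, ∑ n ∈ S, (u n * τ ^ (m₀ + i : ℤ) - v n * τ ^ (-(m₀ + i : ℤ))) /
      (((m₀ + i : ℤ) : F) - a n) = 0) :
    τ ^ 2 = 1 := by
  classical
  set f : (ι → F) → F[X] := fun w ↦ ∑ n ∈ S, C (w n) * ∏ k ∈ S.erase n, (X - C (a k)) with hf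
  have hcard : 1 ≤ S.card := hS.card_pos
  have hdeg : ∀ w, (f w).natDegree ≤ S.card - 1 := by
    intro w
    refine natDegree_sum_le_of_forall_le _ _ fun n hn ↦ ?_
    refine (natDegree_C_mul_le _ _).trans ?_
    rw [natDegree_prod_of_monic _ _ fun k _ ↦ monic_X_sub_C _]
    simp [Finset.card_erase_of_mem hn]
  have heval : ∀ w (x : F), (∀ n ∈ S, x ≠ a n) →
      (f w).eval x = (∏ k ∈ S, (x - a k)) * ∑ n ∈ S, w n / (x - a n) := by
    intro w x hx
    simp only [hf, eval_finsetSum, eval_mul, eval_C, eval_prod, eval_sub, eval_X, Finset.mul_sum]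
    refine Finset.sum_congr rfl fun n hn ↦ ?_
    rw [← Finset.mul_prod_erase S _ hn]
    field_simp [sub_ne_zero.2 (hx n hn)]
  have hne : ∀ w, (∀ n ∈ S, w n ≠ 0) → f w ≠ 0 := by
    intro w hw h0
    obtain ⟨n, hn⟩ := hS
    have h1 : (f w).eval (a n) = w n * ∏ k ∈ S.erase n, (a n - a k) := by
      simp only [hf, eval_finsetSum, eval_mul, eval_C, eval_prod, eval_sub, eval_X]
      rw [Finset.sum_eq_single n]
      · intro k hk hkn
        rw [Finset.prod_eq_zero (i := n) (by simp [hn, hkn.symm]) (sub_self _), mul_zero]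
      · exact fun h ↦ absurd hn h
    rw [h0, eval_zero] at h1
    refine mul_ne_zero (hw n hn) (Finset.prod_ne_zero_iff.2 fun k hk ↦ ?_) h1.symm
    rw [Finset.mem_erase] at hk
    exact sub_ne_zero.2 fun e ↦ hk.1 (ha hn hk.2 e).symm
  have hrel : ∀ i < L, (f u).eval ((m₀ + i : ℤ) : F) * τ ^ (m₀ + i : ℤ) =
      (f v).eval ((m₀ + i : ℤ) : F) * τ ^ (-(m₀ + i : ℤ)) := by
    intro i hi
    rw [heval u _ (hpole i hi), heval v _ (hpole i hi), ← sub_eq_zero]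
    have := h i hi
    calc _ = (∏ k ∈ S, (((m₀ + i : ℤ) : F) - a k)) * ∑ n ∈ S,
          (u n * τ ^ (m₀ + i : ℤ) - v n * τ ^ (-(m₀ + i : ℤ))) / (((m₀ + i : ℤ) : F) - a n) := by
          rw [mul_assoc, mul_assoc, ← mul_sub, Finset.sum_mul, Finset.sum_mul,
            ← Finset.sum_sub_distrib]
          congr 1
          refine Finset.sum_congr rfl fun n _ ↦ ?_
          ring
      _ = 0 := by rw [this, mul_zero]
  set g : F[X] := f u * (f v).comp (X + 1) - C (τ ^ 2) * (f v * (f u).comp (X + 1)) with hg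
  have hcomp : ∀ w, ((f w).comp (X + 1)).natDegree = (f w).natDegree := by
    intro w
    have := natDegree_comp (p := f w) (q := X + C 1)
    rwa [natDegree_X_add_C, mul_one, C_1] at this
  have hcompl : ∀ w, ((f w).comp (X + 1)).leadingCoeff = (f w).leadingCoeff := by
    intro w
    have := leadingCoeff_comp (p := f w) (q := X + C 1) (by rw [natDegree_X_add_C]; simp)
    rwa [leadingCoeff_X_add_C, one_pow, mul_one, C_1] at this
  have hgdeg : g.natDegree ≤ 2 * (S.card - 1) := by
    refine (natDegree_sub_le _ _).trans (max_le ?_ ?_)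
    · refine natDegree_mul_le.trans ?_
      rw [hcomp]
      have := hdeg u; have := hdeg v; lia
    · refine (natDegree_C_mul_le _ _).trans (natDegree_mul_le.trans ?_)
      rw [hcomp]
      have := hdeg u; have := hdeg v; lia
  have hg0 : g = 0 := by
    refine eq_zero_of_natDegree_lt_card_of_eval_eq_zero' g
      ((Finset.range (L - 1)).image fun i : ℕ ↦ ((m₀ + i : ℤ) : F)) ?_ ?_
    · simp only [Finset.mem_image, Finset.mem_range]
      rintro _ ⟨i, hi, rfl⟩
      have h1 := hrel i (by lia)
      have h2 := hrel (i + 1) (by lia)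
      have hc : ((m₀ + (i + 1 : ℕ) : ℤ) : F) = ((m₀ + i : ℤ) : F) + 1 := by push_cast; ring
      have hz : (m₀ + (i + 1 : ℕ) : ℤ) = (m₀ + i : ℤ) + 1 := by push_cast; ring
      rw [hc, hz, zpow_neg, zpow_add_one₀ hτ] at h2
      rw [zpow_neg] at h1
      have ht : τ ^ (m₀ + i : ℤ) ≠ 0 := zpow_ne_zero _ hτ
      simp only [hg, eval_sub, eval_mul, eval_comp, eval_add, eval_X, eval_one, eval_C]
      set t := τ ^ (m₀ + i : ℤ)
      set A := (f u).eval ((m₀ + i : ℤ) : F)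
      set B := (f v).eval ((m₀ + i : ℤ) : F)
      set A' := (f u).eval (((m₀ + i : ℤ) : F) + 1)
      set B' := (f v).eval (((m₀ + i : ℤ) : F) + 1)
      field_simp at h1 h2
      have h3 : B' = A' * t ^ 2 * τ ^ 2 := by linear_combination -h2
      have h4 : B = A * t ^ 2 := by linear_combination -h1
      rw [h3, h4]; ring
    · rw [Finset.card_image_of_injOn]
      · rw [Finset.card_range]; lia
      · intro i hi j hj hij
        simp only [Finset.coe_range, Set.mem_Iio] at hi hj
        exact hinj i (by lia) j (by lia) hij
  rw [hg, sub_eq_zero] at hg0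
  have := congrArg leadingCoeff hg0
  simp only [leadingCoeff_mul, leadingCoeff_C, hcompl] at this
  have hu0 := leadingCoeff_ne_zero.2 (hne u hu)
  have hv0 := leadingCoeff_ne_zero.2 (hne v hv)
  have h5 : (f u).leadingCoeff * (f v).leadingCoeff * (τ ^ 2 - 1) = 0 := by
    linear_combination -this
  simpa [hu0, hv0, sub_eq_zero] using h5

/-! ### Relations between residue classes -/

/-- For `m₀ ≤ m < m₀ + L` the terms of the relation between the classes of `m` and `-m` are the
`e |m + p n|` with `|m + p n| < q`, and the hypotheses on the window say that these are the `n` with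
`-N₁ ≤ n < N₂`, whatever `m` is. The relations thus have a common set of poles `-p n`. They force
`τ ^ 2 = 1` as soon as the window has at least twice as many elements as there are poles. -/
theorem sq_eq_one_of_window {p q : ℕ} [Fact q.Prime] (hp : 2 < p) (hpq : ¬ q ∣ p)
    (e : ℕ → ZMod q) (τ c : ZMod q) (hτ : τ ≠ 0) (hc : c ≠ 0)
    (he : ∀ j : ℕ, 1 ≤ j → j < q → (j : ZMod q) * e j = c * (τ ^ (j : ℤ) - τ ^ (2 - j : ℤ)))
    (hrel : ∀ m : ℤ, ∑ j ∈ (Finset.Icc 1 q).filter (fun j : ℕ ↦ (j : ℤ) ≡ m [ZMOD p]), e j =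
      ∑ j ∈ (Finset.Icc 1 q).filter (fun j : ℕ ↦ (j : ℤ) ≡ -m [ZMOD p]), e j)
    (N₁ N₂ L : ℕ) (m₀ : ℤ) (hN₂ : 1 ≤ N₂) (hL : 2 * (N₁ + N₂) ≤ L)
    (hm₀ : 0 < m₀) (hm₁ : m₀ + L ≤ p) (h₁ : m₀ + L - 1 + p * (N₂ - 1) < q) (h₂ : q < m₀ + p * N₂)
    (h₃ : p * N₁ - m₀ < q) (h₄ : q < p * (N₁ + 1) - (m₀ + L - 1)) :
    τ ^ 2 = 1 := by
  have hq : q.Prime := Fact.out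
  have hcast : ∀ k : ℤ, k ≠ 0 → |k| < q → (k : ZMod q) ≠ 0 := by
    intro k hk hlt h0
    rw [ZMod.intCast_zmod_eq_zero_iff_dvd] at h0
    exact hk (Int.eq_zero_of_abs_lt_dvd h0 hlt)
  -- the terms `j = m + p n` with `n ≥ 0` and `j = -(m + p n)` with `n < 0` of the relation for `m`
  have hterm : ∀ i < L, ∀ n ∈ Finset.Ico (-N₁ : ℤ) N₂,
      (m₀ + i) + p * n ≠ 0 ∧ |(m₀ + i) + p * n| < q := by
    intro i hi n hn
    rw [Finset.mem_Ico] at hn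
    have hi' : (i : ℤ) ≤ L - 1 := by lia
    refine ⟨?_, abs_lt.2 ⟨?_, ?_⟩⟩
    · intro h0
      have hm : (0 : ℤ) < m₀ + i := by lia
      have hm' : m₀ + i < p := by lia
      rcases lt_trichotomy n 0 with h | h | h
      · nlinarith
      · subst h; lia
      · nlinarith
    · nlinarith
    · nlinarith
  refine sq_eq_one_of_forall_sum_div_eq_zero (Finset.Ico (-N₁ : ℤ) N₂) ⟨0, by simp; lia⟩
    (fun n ↦ ((-(p * n) : ℤ) : ZMod q)) (fun n ↦ if 0 ≤ n then τ ^ (p * n) else -τ ^ (2 + p * n))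
    (fun n ↦ if 0 ≤ n then τ ^ (2 - p * n) else -τ ^ (-(p * n))) ?_ ?_ ?_ τ hτ m₀ L
    (by rw [Int.card_Ico]; lia) ?_ ?_ ?_
  · intro n hn k hk hnk
    simp only [Finset.coe_Ico, Set.mem_Ico] at hn hk
    have h0 : ((p * (n - k) : ℤ) : ZMod q) = 0 := by
      push_cast at hnk ⊢
      linear_combination -hnk
    rw [ZMod.intCast_zmod_eq_zero_iff_dvd] at h0
    rcases (Nat.prime_iff_prime_int.1 hq).dvd_or_dvd h0 with h | h
    · exact absurd (by exact_mod_cast h) hpq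
    · have : |n - k| < q := by
        have hp' : (2 : ℤ) < p := by exact_mod_cast hp
        have hL' : 2 * (N₁ + N₂ : ℤ) ≤ L := by exact_mod_cast hL
        have : (N₁ + N₂ - 1 : ℤ) < q := by nlinarith
        exact abs_lt.2 ⟨by lia, by lia⟩
      have := Int.eq_zero_of_abs_lt_dvd h this
      lia
  · intro n _
    split_ifs
    · exact zpow_ne_zero _ hτ
    · exact neg_ne_zero.2 (zpow_ne_zero _ hτ)
  · intro n _
    split_ifs
    · exact zpow_ne_zero _ hτ
    · exact neg_ne_zero.2 (zpow_ne_zero _ hτ)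
  · intro i hi j hj hij
    by_contra hne
    refine hcast ((m₀ + i) - (m₀ + j)) (by lia) ?_ (by rw [Int.cast_sub, hij, sub_self])
    have : (0 : ℤ) ≤ p * (N₂ - 1) := mul_nonneg (by lia) (by lia)
    exact abs_lt.2 ⟨by lia, by lia⟩
  · intro i hi n hn h0
    obtain ⟨h5, h6⟩ := hterm i hi n hn
    refine hcast _ h5 h6 ?_
    rw [Int.cast_add, h0]; push_cast; ring
  · intro i hi
    set m : ℤ := m₀ + i with hm
    have hm0 : 0 < m := by lia
    have hmp : m < p := by lia
    have hmL : m ≤ m₀ + L - 1 := by lia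
    have key : ∑ j ∈ (Finset.Icc 1 q).filter (fun j : ℕ ↦ (j : ℤ) ≡ m [ZMOD p]), e j =
        ∑ n ∈ Finset.Ico (-N₁ : ℤ) N₂ with 0 ≤ n, e (m + p * n).natAbs := by
      refine (Finset.sum_bij' (fun n _ ↦ (m + p * n).natAbs) (fun (j : ℕ) _ ↦ (j - m) / p)
        ?_ ?_ ?_ ?_ fun _ _ ↦ rfl).symm
      · intro n hn
        simp only [Finset.mem_filter, Finset.mem_Ico] at hn
        have h5 := hterm i hi n (by simp [hn.1])
        rw [← hm] at h5
        have h6 : 0 ≤ m + p * n := add_nonneg hm0.le (mul_nonneg (by lia) hn.2)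
        simp only [Finset.mem_filter, Finset.mem_Icc]
        rw [abs_of_nonneg h6] at h5
        refine ⟨by lia, ?_⟩
        rw [Int.natAbs_of_nonneg h6]
        exact (Int.modEq_iff_dvd.2 ⟨-n, by ring⟩)
      · intro j hj
        simp only [Finset.mem_filter, Finset.mem_Icc] at hj
        obtain ⟨n, hn⟩ := (Int.modEq_iff_dvd.1 hj.2.symm)
        have hp0 : (p : ℤ) ≠ 0 := by lia
        have h1j : (1 : ℤ) ≤ j := by exact_mod_cast hj.1.1
        have hjq : (j : ℤ) ≤ q := by exact_mod_cast hj.1.2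
        simp only [Finset.mem_filter, Finset.mem_Ico]
        rw [hn, Int.mul_ediv_cancel_left _ hp0]
        have : 0 ≤ n := by
          by_contra! h
          nlinarith
        refine ⟨⟨by lia, ?_⟩, this⟩
        by_contra! h
        nlinarith
      · intro n hn
        simp only [Finset.mem_filter, Finset.mem_Ico] at hn
        have h6 : 0 ≤ m + p * n := add_nonneg hm0.le (mul_nonneg (by lia) hn.2)
        rw [Int.natAbs_of_nonneg h6, add_sub_cancel_left, Int.mul_ediv_cancel_left _ (by lia)]
      · intro j hj
        simp only [Finset.mem_filter, Finset.mem_Icc] at hj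
        obtain ⟨n, hn⟩ := (Int.modEq_iff_dvd.1 hj.2.symm)
        rw [hn, Int.mul_ediv_cancel_left _ (by lia), ← hn]
        simp
    have key' : ∑ j ∈ (Finset.Icc 1 q).filter (fun j : ℕ ↦ (j : ℤ) ≡ -m [ZMOD p]), e j =
        ∑ n ∈ Finset.Ico (-N₁ : ℤ) N₂ with ¬ 0 ≤ n, e (m + p * n).natAbs := by
      refine (Finset.sum_bij' (fun n _ ↦ (m + p * n).natAbs) (fun (j : ℕ) _ ↦ -((j + m) / p))
        ?_ ?_ ?_ ?_ fun _ _ ↦ rfl).symm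
      · intro n hn
        simp only [Finset.mem_filter, Finset.mem_Ico] at hn
        have h5 := hterm i hi n (by simp [hn.1])
        rw [← hm] at h5
        have h6 : m + p * n ≤ 0 := by nlinarith
        simp only [Finset.mem_filter, Finset.mem_Icc]
        rw [abs_of_nonpos h6] at h5
        refine ⟨by lia, ?_⟩
        rw [Int.ofNat_natAbs_of_nonpos h6]
        exact (Int.modEq_iff_dvd.2 ⟨n, by ring⟩)
      · intro j hj
        simp only [Finset.mem_filter, Finset.mem_Icc] at hj
        obtain ⟨n, hn⟩ := (Int.modEq_iff_dvd.1 hj.2.symm)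
        have hp0 : (p : ℤ) ≠ 0 := by lia
        have h1j : (1 : ℤ) ≤ j := by exact_mod_cast hj.1.1
        have hjq : (j : ℤ) ≤ q := by exact_mod_cast hj.1.2
        rw [sub_neg_eq_add] at hn
        simp only [Finset.mem_filter, Finset.mem_Ico]
        rw [hn, Int.mul_ediv_cancel_left _ hp0]
        have : 0 < n := by
          by_contra! h
          nlinarith
        refine ⟨⟨?_, by lia⟩, by lia⟩
        by_contra! h
        have : (N₁ : ℤ) + 1 ≤ n := by lia
        nlinarith
      · intro n hn
        simp only [Finset.mem_filter, Finset.mem_Ico] at hn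
        have h6 : m + p * n ≤ 0 := by nlinarith
        rw [Int.ofNat_natAbs_of_nonpos h6,
          show -(m + p * n) + m = p * (-n) by ring, Int.mul_ediv_cancel_left _ (by lia), neg_neg]
      · intro j hj
        simp only [Finset.mem_filter, Finset.mem_Icc] at hj
        obtain ⟨n, hn⟩ := (Int.modEq_iff_dvd.1 hj.2.symm)
        rw [sub_neg_eq_add] at hn
        rw [hn, Int.mul_ediv_cancel_left _ (by lia), mul_neg, ← hn]
        simp
    have h7 := hrel m
    rw [key, key', ← sub_eq_zero] at h7
    refine (mul_eq_zero.1 ?_).resolve_left hc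
    rw [← h7, Finset.mul_sum, ← Finset.sum_filter_add_sum_filter_not _ (fun n ↦ 0 ≤ n),
      sub_eq_add_neg, ← Finset.sum_neg_distrib]
    congr 1
    · refine Finset.sum_congr rfl fun n hn ↦ ?_
      simp only [Finset.mem_filter] at hn
      obtain ⟨h5, h6⟩ := hterm i hi n hn.1
      rw [← hm] at h5 h6
      have h8 : 0 ≤ m + p * n := add_nonneg hm0.le (mul_nonneg (by lia) hn.2)
      have h9 := he (m + p * n).natAbs (by lia) (by rw [abs_of_nonneg h8] at h6; lia)
      have h10 := hcast _ h5 h6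
      have hc1 : (((m + p * n).natAbs : ℕ) : ZMod q) = ((m + p * n : ℤ) : ZMod q) := by
        rw [← Int.cast_natCast, Int.natAbs_of_nonneg h8]
      rw [hc1, Int.natAbs_of_nonneg h8] at h9
      rw [if_pos hn.2, if_pos hn.2, ← zpow_add₀ hτ, ← zpow_add₀ hτ]
      have hden : ((m : ZMod q) - ((-(p * n : ℤ) : ℤ) : ZMod q)) = ((m + p * n : ℤ) : ZMod q) := by
        push_cast; ring
      simp only [Int.cast_neg] at hden ⊢
      rw [hden, mul_div_assoc', div_eq_iff h10, mul_comm (e _), h9]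
      ring_nf
    · refine Finset.sum_congr rfl fun n hn ↦ ?_
      simp only [Finset.mem_filter] at hn
      obtain ⟨h5, h6⟩ := hterm i hi n hn.1
      rw [← hm] at h5 h6
      have h8 : m + p * n ≤ 0 := by nlinarith
      have h9 := he (m + p * n).natAbs (by lia) (by rw [abs_of_nonpos h8] at h6; lia)
      have h10 := hcast _ h5 h6
      have hc1 : (((m + p * n).natAbs : ℕ) : ZMod q) = -((m + p * n : ℤ) : ZMod q) := by
        rw [← Int.cast_natCast, Int.ofNat_natAbs_of_nonpos h8, Int.cast_neg]
      rw [hc1, Int.ofNat_natAbs_of_nonpos h8] at h9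
      rw [if_neg hn.2, if_neg hn.2, neg_mul, neg_mul, ← zpow_add₀ hτ, ← zpow_add₀ hτ]
      have hden : ((m : ZMod q) - ((-(p * n : ℤ) : ℤ) : ZMod q)) = ((m + p * n : ℤ) : ZMod q) := by
        push_cast; ring
      simp only [Int.cast_neg] at hden ⊢
      rw [hden, mul_div_assoc', div_eq_iff h10, neg_mul (e _), mul_comm (e _),
        ← neg_mul (Int.cast _), h9]
      ring_nf

/-- The window argument applied to every pair of distinct odd primes in the given range: with
`q = p N + r` and `0 < r < p`, one of the two windows `(0, min r (p - r))` and
`(min r (p - r), max r (p - r))` is long enough, except for `(p, q) = (5, 3)` and `(7, 5)`. -/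
theorem sq_eq_one_of_class_sums {p q : ℕ} (hp : p.Prime) [Fact q.Prime] (hp2 : p ≠ 2)
    (hq2 : q ≠ 2) (hpq : p ≠ q) (hb : q < p ∨ 16 * q + 20 * p < p * p)
    (e : ℕ → ZMod q) (τ c : ZMod q) (hτ : τ ≠ 0) (hc : c ≠ 0)
    (he : ∀ j : ℕ, 1 ≤ j → j < q → (j : ZMod q) * e j = c * (τ ^ (j : ℤ) - τ ^ (2 - j : ℤ)))
    (hrel : ∀ m : ℤ, ∑ j ∈ (Finset.Icc 1 q).filter (fun j : ℕ ↦ (j : ℤ) ≡ m [ZMOD p]), e j =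
      ∑ j ∈ (Finset.Icc 1 q).filter (fun j : ℕ ↦ (j : ℤ) ≡ -m [ZMOD p]), e j) :
    τ ^ 2 = 1 := by
  have hq : q.Prime := Fact.out
  have hp3 : 2 < p := lt_of_le_of_ne hp.two_le (Ne.symm hp2)
  have hq3 : 2 < q := lt_of_le_of_ne hq.two_le (Ne.symm hq2)
  have hqp : ¬ q ∣ p := fun h ↦ hpq ((Nat.prime_dvd_prime_iff_eq hq hp).1 h).symm
  have hpodd : p % 2 = 1 := hp.eq_two_or_odd.resolve_left hp2
  have hqodd : q % 2 = 1 := hq.eq_two_or_odd.resolve_left hq2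
  obtain ⟨N, r, hN, hr0, hrp⟩ : ∃ N r : ℕ, q = p * N + r ∧ 0 < r ∧ r < p := by
    refine ⟨q / p, q % p, (Nat.div_add_mod q p).symm, Nat.pos_of_ne_zero fun h ↦ ?_,
      Nat.mod_lt _ hp.pos⟩
    exact hpq ((Nat.prime_dvd_prime_iff_eq hp hq).1 (Nat.dvd_of_mod_eq_zero h))
  have hNb : N = 0 ∨ 16 * N + 21 ≤ p := by
    rcases hb with h | h
    · left
      by_contra h0
      have : 1 ≤ N := Nat.one_le_iff_ne_zero.2 h0
      nlinarith
    · right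
      by_contra! h0
      have : p * p ≤ p * (16 * N + 20) := Nat.mul_le_mul_left _ (by lia)
      nlinarith
  have hNz : (q : ℤ) = p * N + r := by exact_mod_cast hN
  have hp2r : p ≠ 2 * r := by lia
  rcases lt_or_gt_of_ne hp2r with h2 | h2
  · -- `p < 2 r`
    by_cases hA : 4 * N + 3 ≤ p - r
    · refine sq_eq_one_of_window hp3 hqp e τ c hτ hc he hrel N (N + 1) (p - r - 1) 1 (by lia)
        (by lia) (by lia) ?_ ?_ ?_ ?_ ?_
      all_goals zify [show 1 ≤ p - r by lia, hrp.le] at *; ring_nf at *; lia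
    by_cases hB : 4 * N + 5 ≤ 2 * r - p
    · refine sq_eq_one_of_window hp3 hqp e τ c hτ hc he hrel (N + 1) (N + 1) (2 * r - p - 1)
        (p - r + 1) (by lia) (by lia) (by lia) ?_ ?_ ?_ ?_ ?_
      all_goals zify [show 1 ≤ 2 * r - p by lia, h2.le] at *; ring_nf at *; lia
    have hN0 : N = 0 := by lia
    subst hN0
    have hqr : q = r := by lia
    subst hqr
    have h35 : (p = 5 ∧ q = 3) ∨ (p = 7 ∧ q = 5) := by lia
    rcases h35 with ⟨rfl, rfl⟩ | ⟨rfl, rfl⟩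
    · exact ZMod.pow_card_sub_one_eq_one hτ
    · -- the relation `e 3 = e 4`, where `e 3 = 0` because `τ ^ 4 = 1`
      have h4 : τ ^ 4 = 1 := ZMod.pow_card_sub_one_eq_one hτ
      have h3 := hrel 3
      rw [show (Finset.Icc 1 5).filter (fun j : ℕ ↦ (j : ℤ) ≡ 3 [ZMOD (7 : ℕ)]) = {3} by decide,
        show (Finset.Icc 1 5).filter (fun j : ℕ ↦ (j : ℤ) ≡ -3 [ZMOD (7 : ℕ)]) = {4} by decide,
        Finset.sum_singleton, Finset.sum_singleton] at h3
      have e3 := he 3 (by lia) (by lia)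
      have e4 := he 4 (by lia) (by lia)
      have hi1 : τ ^ (2 - (3 : ℕ) : ℤ) = τ ^ 3 := by
        rw [show (2 - (3 : ℕ) : ℤ) = -1 by norm_num, zpow_neg_one]
        exact inv_eq_of_mul_eq_one_left (by rw [← h4]; ring)
      have hi2 : τ ^ (2 - (4 : ℕ) : ℤ) = τ ^ 2 := by
        rw [show (2 - (4 : ℕ) : ℤ) = -2 by norm_num, zpow_neg]
        exact inv_eq_of_mul_eq_one_left (by rw [← h4]; norm_cast; ring)
      rw [hi1, zpow_natCast, sub_self, mul_zero] at e3
      rw [hi2, zpow_natCast, h4, ← h3] at e4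
      have h30 : e 3 = 0 := (mul_eq_zero.1 e3).resolve_left
        ((ZMod.natCast_eq_zero_iff 3 5).not.2 (by norm_num))
      rw [h30, mul_zero, eq_comm] at e4
      exact (sub_eq_zero.1 ((mul_eq_zero.1 e4).resolve_left hc)).symm
  · -- `2 r < p`
    by_cases hA : 4 * N + 3 ≤ r
    · refine sq_eq_one_of_window hp3 hqp e τ c hτ hc he hrel N (N + 1) (r - 1) 1 (by lia)
        (by lia) (by lia) ?_ ?_ ?_ ?_ ?_
      all_goals zify [show 1 ≤ r by lia] at *; ring_nf at *; lia
    have hN1 : 1 ≤ N := by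
      by_contra! h0
      have : N = 0 := by lia
      subst this
      lia
    refine sq_eq_one_of_window hp3 hqp e τ c hτ hc he hrel N N (p - 2 * r - 1) (r + 1) hN1
      (by lia) (by lia) ?_ ?_ ?_ ?_ ?_
    all_goals zify [show 1 ≤ p - 2 * r by lia, h2.le] at *; ring_nf at *; lia

/-! ### From the class sums to divisibility by the square of the prime -/

theorem exists_choose_mul_sub_div (q : ℕ) (hq : q.Prime) (x y : ℤ) :
    ∃ e : ℕ → ℤ, ∀ j, 1 ≤ j → j ≤ q →
      (q : ℤ) * e j = q.choose j * (x ^ j * y ^ (q + 1 - j) - x ^ (q + 1 - j) * y ^ j) := by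
  have : Fact q.Prime := ⟨hq⟩
  have h : ∀ j, ∃ k : ℤ, 1 ≤ j → j ≤ q →
      (q : ℤ) * k = q.choose j * (x ^ j * y ^ (q + 1 - j) - x ^ (q + 1 - j) * y ^ j) := by
    intro j
    by_cases hj : 1 ≤ j ∧ j ≤ q
    · suffices (q : ℤ) ∣ q.choose j * (x ^ j * y ^ (q + 1 - j) - x ^ (q + 1 - j) * y ^ j) by
        obtain ⟨k, hk⟩ := this
        exact ⟨k, fun _ _ ↦ hk.symm⟩
      rcases hj.2.lt_or_eq with h | h
      · exact (Int.natCast_dvd_natCast.2 (hq.dvd_choose_self (by lia) h)).mul_right _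
      · subst h
        refine Dvd.dvd.mul_left ?_ _
        rw [← ZMod.intCast_zmod_eq_zero_iff_dvd]
        push_cast
        rw [ZMod.pow_card, ZMod.pow_card, show j + 1 - j = 1 by lia]
        ring
    · exact ⟨0, fun h1 h2 ↦ absurd ⟨h1, h2⟩ hj⟩
  choose e he using h
  exact ⟨e, he⟩

theorem choose_prime_sub_one_eq_neg_one_pow (q : ℕ) [Fact q.Prime] (j : ℕ) (hj : j < q) :
    (((q - 1).choose j : ℕ) : ZMod q) = (-1) ^ j := by
  have hq : q.Prime := Fact.out
  induction j with
  | zero => simp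
  | succ j ih =>
    have h1 : q.choose (j + 1) = (q - 1).choose j + (q - 1).choose (j + 1) := by
      obtain ⟨n, rfl⟩ : ∃ n, q = n + 1 := ⟨q - 1, by have := hq.pos; lia⟩
      exact Nat.choose_succ_succ n j
    have h2 : ((q.choose (j + 1) : ℕ) : ZMod q) = 0 :=
      (ZMod.natCast_eq_zero_iff _ _).2 (hq.dvd_choose_self (by lia) hj)
    rw [h1, Nat.cast_add, ih (by lia)] at h2
    rw [pow_succ]
    linear_combination h2

/-- The value modulo `q` of the coefficient `e j`, by `q.choose j / q ≡ (-1) ^ (j - 1) / j`. -/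
theorem mul_coeff_eq {q : ℕ} [Fact q.Prime] {x y : ℤ} {e : ℕ → ℤ}
    (he : ∀ j, 1 ≤ j → j ≤ q →
      (q : ℤ) * e j = q.choose j * (x ^ j * y ^ (q + 1 - j) - x ^ (q + 1 - j) * y ^ j))
    (j : ℕ) (h1 : 1 ≤ j) (h2 : j < q) :
    (j : ZMod q) * (e j : ZMod q) =
      (-1) ^ (j - 1) * ((x : ZMod q) ^ j * y ^ (q + 1 - j) - x ^ (q + 1 - j) * y ^ j) := by
  have hq : q.Prime := Fact.out
  have hj := he j h1 h2.le
  have hch : (j : ℤ) * q.choose j = q * (q - 1).choose (j - 1) := by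
    have := Nat.add_one_mul_choose_eq (q - 1) (j - 1)
    rw [Nat.sub_add_cancel hq.pos,
      Nat.sub_add_cancel h1] at this
    have h := congrArg (Nat.cast : ℕ → ℤ) this
    push_cast at h
    linear_combination -h
  have hz : (j : ℤ) * e j =
      (q - 1).choose (j - 1) * (x ^ j * y ^ (q + 1 - j) - x ^ (q + 1 - j) * y ^ j) := by
    refine mul_left_cancel₀ (Int.natCast_ne_zero.2 hq.ne_zero) ?_
    linear_combination (j : ℤ) * hj +
      (x ^ j * y ^ (q + 1 - j) - x ^ (q + 1 - j) * y ^ j) * hch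
  have := congrArg (Int.cast : ℤ → ZMod q) hz
  push_cast at this
  rw [this, choose_prime_sub_one_eq_neg_one_pow q _ (by lia)]

/-- What the relations between the class sums say about `x` and `y`. With `τ = -x / y` they have the
shape required by the window argument, so `x ^ 2 = y ^ 2` modulo `q`. All `e j` with `j < q` then
vanish modulo `q`, and the relation for the class of `q` leaves `e q = x ^ q y - x y ^ q`, divided
by `q`. -/
theorem sq_dvd_of_class_sums {p q : ℕ} (hp : p.Prime) (hq : q.Prime) (hp2 : p ≠ 2)
    (hq2 : q ≠ 2) (hpq : p ≠ q) (hb : q < p ∨ 16 * q + 20 * p < p * p) {x y : ℤ} {e : ℕ → ℤ}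
    (he : ∀ j, 1 ≤ j → j ≤ q →
      (q : ℤ) * e j = q.choose j * (x ^ j * y ^ (q + 1 - j) - x ^ (q + 1 - j) * y ^ j))
    (hrel : ∀ m : ℤ, ∑ j ∈ (Finset.Icc 1 q).filter (fun j : ℕ ↦ (j : ℤ) ≡ m [ZMOD p]), e j ≡
      ∑ j ∈ (Finset.Icc 1 q).filter (fun j : ℕ ↦ (j : ℤ) ≡ -m [ZMOD p]), e j [ZMOD q]) :
    (¬ (q : ℤ) ∣ x → ¬ (q : ℤ) ∣ y → (q : ℤ) ∣ x ^ 2 - y ^ 2) ∧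
      (q : ℤ) ^ 2 ∣ x ^ q * y - x * y ^ q := by
  have : Fact q.Prime := ⟨hq⟩
  have hqodd : Odd q := hq.odd_of_ne_two hq2
  have hrel' : ∀ m : ℤ,
      ∑ j ∈ (Finset.Icc 1 q).filter (fun j : ℕ ↦ (j : ℤ) ≡ m [ZMOD p]), (e j : ZMod q) =
      ∑ j ∈ (Finset.Icc 1 q).filter (fun j : ℕ ↦ (j : ℤ) ≡ -m [ZMOD p]), (e j : ZMod q) := by
    intro m
    have := (ZMod.intCast_eq_intCast_iff _ _ q).2 (hrel m)
    push_cast at this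
    exact this
  have hτ : ¬ (q : ℤ) ∣ x → ¬ (q : ℤ) ∣ y → (x : ZMod q) ^ 2 = (y : ZMod q) ^ 2 := by
    intro hx hy
    have hx0 : (x : ZMod q) ≠ 0 := by rwa [Ne, ZMod.intCast_zmod_eq_zero_iff_dvd]
    have hy0 : (y : ZMod q) ≠ 0 := by rwa [Ne, ZMod.intCast_zmod_eq_zero_iff_dvd]
    set τ : ZMod q := -x / y with hτdef
    have hτ0 : τ ≠ 0 := div_ne_zero (neg_ne_zero.2 hx0) hy0
    have hxτ : (x : ZMod q) = -τ * y := by rw [hτdef]; field_simp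
    have hyq : (y : ZMod q) ^ (q + 1) = y ^ 2 := by rw [pow_succ, ZMod.pow_card, sq]
    have h1 : τ ^ 2 = 1 := by
      refine sq_eq_one_of_class_sums hp hp2 hq2 hpq hb (fun j ↦ (e j : ZMod q)) τ
        (-(y : ZMod q) ^ 2) hτ0 (neg_ne_zero.2 (pow_ne_zero _ hy0)) ?_ hrel'
      intro j hj1 hj2
      rw [mul_coeff_eq he j hj1 hj2, hxτ]
      have hz : τ ^ (2 - j : ℤ) = τ ^ (q + 1 - j) := by
        rw [← zpow_natCast, Nat.cast_sub (by lia), Nat.cast_add, Nat.cast_one, add_sub_assoc,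
          zpow_add₀ hτ0, zpow_natCast, ZMod.pow_card, ← zpow_one_add₀ hτ0]
        congr 1; ring
      rw [hz, zpow_natCast, mul_pow, mul_pow, neg_pow τ j, neg_pow τ (q + 1 - j), ← hyq]
      have hs1 : (-1 : ZMod q) ^ (j - 1) * (-1) ^ j = -1 := by
        rw [← pow_add]
        exact Odd.neg_one_pow ⟨j - 1, by lia⟩
      have hs2 : (-1 : ZMod q) ^ (j - 1) * (-1) ^ (q + 1 - j) = -1 := by
        rw [← pow_add, show j - 1 + (q + 1 - j) = q by lia]
        exact hqodd.neg_one_pow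
      have hy1 : (y : ZMod q) ^ (q + 1) = y ^ j * y ^ (q + 1 - j) := by
        rw [← pow_add]; congr 1; lia
      rw [hy1]
      linear_combination (τ ^ j * (y : ZMod q) ^ j * y ^ (q + 1 - j)) * hs1 -
        (τ ^ (q + 1 - j) * (y : ZMod q) ^ j * y ^ (q + 1 - j)) * hs2
    rw [hxτ]
    linear_combination (y : ZMod q) ^ 2 * h1
  -- the middle coefficients vanish modulo `q`
  have hmid : ∀ j, 1 ≤ j → j < q → (e j : ZMod q) = 0 := by
    intro j h1 h2
    have hj0 : (j : ZMod q) ≠ 0 := by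
      rw [Ne, ZMod.natCast_eq_zero_iff]
      exact Nat.not_dvd_of_pos_of_lt h1 h2
    refine (mul_eq_zero.1 ((mul_coeff_eq he j h1 h2).trans ?_)).resolve_left hj0
    by_cases hx : (q : ℤ) ∣ x
    · rw [(ZMod.intCast_zmod_eq_zero_iff_dvd x q).2 hx, zero_pow (by lia), zero_pow (by lia)]; ring
    by_cases hy : (q : ℤ) ∣ y
    · rw [(ZMod.intCast_zmod_eq_zero_iff_dvd y q).2 hy, zero_pow (by lia), zero_pow (by lia)]; ring
    have h3 := hτ hx hy
    have key : (x : ZMod q) ^ j * y ^ (q + 1 - j) = x ^ (q + 1 - j) * y ^ j := by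
      have hev : Even (q + 1) := hqodd.add_one
      rcases le_total j (q + 1 - j) with h4 | h4
      · obtain ⟨k, hk⟩ : ∃ k, q + 1 - j = j + 2 * k := by
          obtain ⟨t, ht⟩ := hev; exact ⟨t - j, by lia⟩
        rw [hk, pow_add, pow_add, pow_mul, pow_mul, h3]; ring
      · obtain ⟨k, hk⟩ : ∃ k, j = (q + 1 - j) + 2 * k := by
          obtain ⟨t, ht⟩ := hev; exact ⟨j - t, by lia⟩
        have : (x : ZMod q) ^ j * y ^ (q + 1 - j) =
            x ^ (q + 1 - j + 2 * k) * y ^ (q + 1 - j) := by rw [← hk]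
        rw [this]
        have : (x : ZMod q) ^ (q + 1 - j) * y ^ j =
            x ^ (q + 1 - j) * y ^ (q + 1 - j + 2 * k) := by rw [← hk]
        rw [this, pow_add, pow_add, pow_mul, pow_mul, h3]; ring
    rw [key, sub_self, mul_zero]
  refine ⟨fun hx hy ↦ ?_, ?_⟩
  · rw [← ZMod.intCast_zmod_eq_zero_iff_dvd]
    push_cast
    rw [hτ hx hy, sub_self]
  · have h1 := hrel' q
    rw [Finset.sum_eq_single q, Finset.sum_eq_zero] at h1
    · rw [ZMod.intCast_zmod_eq_zero_iff_dvd] at h1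
      obtain ⟨k, hk⟩ := h1
      have h2 := he q hq.one_le le_rfl
      rw [Nat.choose_self, show q + 1 - q = 1 by lia, hk] at h2
      exact ⟨k, by linear_combination -h2⟩
    · intro j hj
      simp only [Finset.mem_filter, Finset.mem_Icc] at hj
      refine hmid j hj.1.1 (lt_of_le_of_ne hj.1.2 ?_)
      rintro rfl
      have h3 := Int.modEq_iff_dvd.1 hj.2.symm
      rw [sub_neg_eq_add, ← two_mul] at h3
      have h4 : p ∣ 2 * j := by exact_mod_cast h3
      rcases hp.dvd_mul.1 h4 with h | h
      · exact hp2 ((Nat.prime_dvd_prime_iff_eq hp Nat.prime_two).1 h)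
      · exact hpq ((Nat.prime_dvd_prime_iff_eq hp hq).1 h)
    · intro j hj hjq
      simp only [Finset.mem_filter, Finset.mem_Icc] at hj
      exact hmid j hj.1.1 (lt_of_le_of_ne hj.1.2 hjq)
    · intro h
      refine absurd ?_ h
      simp only [Finset.mem_filter, Finset.mem_Icc]
      exact ⟨⟨hq.one_le, le_rfl⟩, Int.ModEq.refl _⟩

theorem sq_dvd_sub_of_sq_dvd_pow_sub {q : ℕ} (hq : q.Prime) {x y : ℤ} (hx : ¬ (q : ℤ) ∣ x)
    (hy : ¬ (q : ℤ) ∣ y) (h : (q : ℤ) ∣ x - y) (h2 : (q : ℤ) ^ 2 ∣ x ^ q * y - x * y ^ q) :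
    (q : ℤ) ^ 2 ∣ x - y := by
  have hqi : Prime (q : ℤ) := Nat.prime_iff_prime_int.1 hq
  obtain ⟨n, hn⟩ : ∃ n, q = n + 1 := ⟨q - 1, by have := hq.pos; lia⟩
  -- the exponent `n = q - 1` is prime to `q`, so lifting the exponent loses nothing
  have h3 : (q : ℤ) ^ 2 ∣ x ^ n - y ^ n := by
    have hcop : IsCoprime ((q : ℤ) ^ 2) (x * y) :=
      IsCoprime.pow_left ((hqi.coprime_iff_not_dvd).2 fun h ↦
        (hqi.dvd_or_dvd h).elim hx hy)
    refine hcop.dvd_of_dvd_mul_left ?_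
    rwa [show x * y * (x ^ n - y ^ n) = x ^ q * y - x * y ^ q by rw [hn]; ring]
  rw [pow_dvd_iff_le_emultiplicity] at h3 ⊢
  rwa [emultiplicity_pow_sub_pow_of_prime hqi h hx] at h3
  intro h4
  have : q ∣ n := by exact_mod_cast h4
  have := Nat.le_of_dvd (by have := hq.two_le; lia) this
  lia

/-- The congruence `x ^ q * y ≡ x * y ^ q` modulo `q ^ 2`, together with `x ≡ ± y` modulo `q` in the
coprime case, lifts to one of the four divisibilities. -/
theorem sq_dvd_of_sq_dvd_pow_mul_sub {q : ℕ} (hq : q.Prime) (hq2 : q ≠ 2) {x y : ℤ}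
    (hxy : IsCoprime x y)
    (h1 : ¬ (q : ℤ) ∣ x → ¬ (q : ℤ) ∣ y → (q : ℤ) ∣ x ^ 2 - y ^ 2)
    (h2 : (q : ℤ) ^ 2 ∣ x ^ q * y - x * y ^ q) :
    (q : ℤ) ^ 2 ∣ x ∨ (q : ℤ) ^ 2 ∣ y ∨ (q : ℤ) ^ 2 ∣ x + y ∨ (q : ℤ) ^ 2 ∣ x - y := by
  have hqi : Prime (q : ℤ) := Nat.prime_iff_prime_int.1 hq
  have aux : ∀ x y : ℤ, IsCoprime x y → (q : ℤ) ∣ x → (q : ℤ) ^ 2 ∣ x ^ q * y - x * y ^ q →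
      (q : ℤ) ^ 2 ∣ x := by
    intro x y hxy hx h
    have hy : ¬ (q : ℤ) ∣ y := fun hy ↦ hqi.not_isUnit (hxy.isUnit_of_dvd' hx hy)
    have h3 : (q : ℤ) ^ 2 ∣ x ^ q * y :=
      Dvd.dvd.mul_right ((pow_dvd_pow_of_dvd hx 2).trans (pow_dvd_pow x hq.two_le)) y
    have h4 : (q : ℤ) ^ 2 ∣ x * y ^ q := by
      have := dvd_sub h3 h
      rwa [sub_sub_cancel] at this
    exact (IsCoprime.pow (hqi.coprime_iff_not_dvd.2 hy)).dvd_of_dvd_mul_right h4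
  by_cases hx : (q : ℤ) ∣ x
  · exact Or.inl (aux x y hxy hx h2)
  by_cases hy : (q : ℤ) ∣ y
  · refine Or.inr (Or.inl (aux y x hxy.symm hy ?_))
    rwa [← dvd_neg, show -(y ^ q * x - y * x ^ q) = x ^ q * y - x * y ^ q by ring]
  have h3 := h1 hx hy
  rw [sq_sub_sq] at h3
  rcases hqi.dvd_or_dvd h3 with h | h
  · refine Or.inr (Or.inr (Or.inl ?_))
    have := sq_dvd_sub_of_sq_dvd_pow_sub hq (x := x) (y := -y) hx (by rwa [dvd_neg])
      (by rwa [sub_neg_eq_add]) (by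
        rwa [(hq.odd_of_ne_two hq2).neg_pow, ← dvd_neg,
          show -(x ^ q * -y - x * -y ^ q) = x ^ q * y - x * y ^ q by ring])
    rwa [sub_neg_eq_add] at this
  · exact Or.inr (Or.inr (Or.inr (sq_dvd_sub_of_sq_dvd_pow_sub hq hx hy h h2)))

/-! ### Class groups of the cyclotomic field and of its real subfield -/

theorem Subgroup.mem_of_pow_eq_one_of_not_dvd_card_div {G : Type*} [CommGroup G] [Finite G]
    (H : Subgroup G) {q : ℕ} (hq : q.Prime) (h : ¬ q ∣ Nat.card G / Nat.card H) {g : G}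
    (hg : g ^ q = 1) : g ∈ H := by
  rw [← H.index_mul_card, Nat.mul_div_cancel _ Nat.card_pos] at h
  rw [← QuotientGroup.eq_one_iff, ← orderOf_eq_one_iff]
  have h1 : orderOf (g : G ⧸ H) ∣ q := by
    rw [orderOf_dvd_iff_pow_eq_one, ← QuotientGroup.mk_pow, hg, QuotientGroup.mk_one]
  refine ((Nat.dvd_prime hq).1 h1).resolve_right fun h2 ↦ h ?_
  rw [← h2, Subgroup.index]
  exact _root_.orderOf_dvd_natCard _

section

open NumberField nonZeroDivisors

theorem isCMField_of_cyclotomic {p : ℕ} [Fact p.Prime] (K : Type*) [Field K] [NumberField K]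
    [IsCyclotomicExtension {p} ℚ K] (hp2 : p ≠ 2) : IsCMField K :=
  IsCyclotomicExtension.Rat.isCMField K (S := {p})
    ⟨p, rfl, lt_of_le_of_ne (Fact.out : p.Prime).two_le (Ne.symm hp2)⟩

section Cyclotomic

variable {p : ℕ} [Fact p.Prime] {K : Type*} [Field K] [NumberField K]
  [IsCyclotomicExtension {p} ℚ K] {ζ : 𝓞 K}

open Polynomial in
theorem exists_aeval_eq (hζ : IsPrimitiveRoot ζ p) (a : 𝓞 K) : ∃ f : ℤ[X], aeval ζ f = a := by
  have hζ' : IsPrimitiveRoot (ζ : K) p := hζ.map_of_injective RingOfIntegers.coe_injective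
  obtain ⟨f, hf⟩ := hζ'.integralPowerBasis.exists_eq_aeval' a
  rw [hζ'.integralPowerBasis_gen] at hf
  exact ⟨f, hf.symm⟩

theorem exists_eq_neg_pow_of_pow_eq_one (hp2 : p ≠ 2) (hζ : IsPrimitiveRoot ζ p) {u : 𝓞 K} {n : ℕ}
    (hn : 0 < n) (hu : u ^ n = 1) : ∃ r : ℕ, u = (-ζ) ^ r := by
  have hζ' : IsPrimitiveRoot (ζ : K) p := hζ.map_of_injective RingOfIntegers.coe_injective
  have hp : p.Prime := Fact.out
  obtain ⟨r, hr⟩ := hζ'.exists_neg_pow_of_isOfFinOrder (hp.odd_of_ne_two hp2) (x := (u : K))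
    (isOfFinOrder_iff_pow_eq_one.2 ⟨n, hn, by rw [← map_pow, hu, map_one]⟩)
  exact ⟨r, RingOfIntegers.coe_injective (by simpa using hr)⟩

variable [IsCMField K]

local notation "σc" => IsCMField.ringOfIntegersComplexConj K

omit [Fact (Nat.Prime p)] [IsCyclotomicExtension {p} ℚ K] in
theorem conj_conj (a : 𝓞 K) : σc (σc a) = a := by
  apply RingOfIntegers.ext; simp

omit [Fact (Nat.Prime p)] [IsCyclotomicExtension {p} ℚ K] in
/-- Kronecker's theorem for a CM field: an integer `u` with `u * σ u = 1` has absolute value `1` at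
every embedding. -/
theorem exists_pow_eq_one_of_mul_conj {u : 𝓞 K} (h : u * σc u = 1) : ∃ n, 0 < n ∧ u ^ n = 1 := by
  obtain ⟨n, hn, hu⟩ := Embeddings.pow_eq_one_of_norm_eq_one K ℂ (x := (u : K))
    u.isIntegral_coe fun φ ↦ by
      have h1 := congrArg (fun a : 𝓞 K ↦ φ (a : K)) h
      simp only [map_mul, map_one, IsCMField.coe_ringOfIntegersComplexConj,
        IsCMField.complexEmbedding_complexConj, Complex.mul_conj] at h1
      have h2 : Complex.normSq (φ u) = 1 := by exact_mod_cast h1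
      rw [Complex.normSq_eq_norm_sq] at h2
      exact (pow_eq_one_iff_of_nonneg (norm_nonneg _) two_ne_zero).1 h2
  exact ⟨n, hn, RingOfIntegers.coe_injective (by simpa using hu)⟩

omit [IsCyclotomicExtension {p} ℚ K] in
theorem mul_conj_eq_one (hζ : IsPrimitiveRoot ζ p) : ζ * σc ζ = 1 := by
  have hp : p.Prime := Fact.out
  let u : (𝓞 K)ˣ := (hζ.isUnit hp.ne_zero).unit
  have hu : u ∈ Units.torsion K := by
    rw [Units.torsion, CommGroup.mem_torsion, isOfFinOrder_iff_pow_eq_one]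
    exact ⟨p, hp.pos, Units.ext hζ.pow_eq_one⟩
  have := IsCMField.complexConj_torsion K ⟨u, hu⟩
  apply RingOfIntegers.coe_injective
  have h0 : (ζ : K) ≠ 0 := RingOfIntegers.coe_ne_zero_iff.2 (hζ.ne_zero hp.ne_zero)
  change (ζ : K) * IsCMField.complexConj K (ζ : K) = 1
  change IsCMField.complexConj K (ζ : K) = _ at this
  rw [this]
  exact mul_inv_cancel₀ h0

omit [IsCyclotomicExtension {p} ℚ K] in
theorem conj_eq_pow (hζ : IsPrimitiveRoot ζ p) : σc ζ = ζ ^ (p - 1) := by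
  have hp : p.Prime := Fact.out
  have h1 : ζ * ζ ^ (p - 1) = 1 := by
    rw [← pow_succ', Nat.sub_add_cancel hp.one_le, hζ.pow_eq_one]
  exact mul_left_cancel₀ (hζ.ne_zero hp.ne_zero) ((mul_conj_eq_one hζ).trans h1.symm)

/-- Complex conjugation acts trivially modulo the prime above `p`. -/
theorem sub_one_dvd_conj_sub (hζ : IsPrimitiveRoot ζ p) (a : 𝓞 K) : ζ - 1 ∣ σc a - a := by
  obtain ⟨f, rfl⟩ := exists_aeval_eq hζ a
  have h1 : σc (Polynomial.aeval ζ f) = Polynomial.aeval (σc ζ) f :=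
    (Polynomial.aeval_algHom_apply ((σc).toAlgHom.restrictScalars ℤ) ζ f).symm
  rw [h1, Polynomial.aeval_def, Polynomial.aeval_def, Polynomial.eval₂_eq_eval_map,
    Polynomial.eval₂_eq_eval_map]
  refine dvd_trans ?_ (Polynomial.sub_dvd_eval_sub _ _ _)
  have h2 : σc ζ - ζ = (ζ ^ (p - 1) - 1) - (ζ - 1) := by rw [conj_eq_pow hζ]; ring
  rw [h2]
  exact dvd_sub (by simpa using sub_dvd_pow_sub_pow ζ 1 (p - 1)) dvd_rfl

omit [IsCMField K] in
theorem zeta_sub_one_prime (hζ : IsPrimitiveRoot ζ p) : Prime (ζ - 1) :=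
  (hζ.map_of_injective RingOfIntegers.coe_injective :
    IsPrimitiveRoot (ζ : K) p).zeta_sub_one_prime'

omit [IsCMField K] in
theorem zeta_sub_one_dvd_prime (hζ : IsPrimitiveRoot ζ p) : ζ - 1 ∣ (p : 𝓞 K) :=
  (hζ.map_of_injective RingOfIntegers.coe_injective :
    IsPrimitiveRoot (ζ : K) p).toInteger_sub_one_dvd_prime'

omit [IsCMField K] in
theorem dvd_of_zeta_sub_one_dvd_intCast (hζ : IsPrimitiveRoot ζ p) {n : ℤ}
    (h : ζ - 1 ∣ (n : 𝓞 K)) : (p : ℤ) ∣ n := by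
  have hp : p.Prime := Fact.out
  by_contra hn
  have hcop : IsCoprime (p : ℤ) n := (Nat.prime_iff_prime_int.1 hp).coprime_iff_not_dvd.2 hn
  have hcop' := hcop.map (Int.castRingHom (𝓞 K))
  refine (zeta_sub_one_prime hζ).not_isUnit (hcop'.isUnit_of_dvd' ?_ ?_)
  · simpa using zeta_sub_one_dvd_prime hζ
  · simpa using h

/-- If `α` and its conjugate generate the same ideal, then after multiplying `α` by a root of unity
it is real or purely imaginary. -/
theorem exists_root_mul_conj_eq_or (hp2 : p ≠ 2) (hζ : IsPrimitiveRoot ζ p) {α : 𝓞 K}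
    (h0 : α ≠ 0) (h : Ideal.span {σc α} = Ideal.span {α}) :
    ∃ s : ℕ, σc (α * ζ ^ s) = α * ζ ^ s ∨ σc (α * ζ ^ s) = -(α * ζ ^ s) := by
  have hp : p.Prime := Fact.out
  obtain ⟨u, hu⟩ := Ideal.mem_span_singleton'.1
    (h ▸ Ideal.mem_span_singleton_self (σc α) : σc α ∈ Ideal.span {α})
  have huu : u * σc u = 1 := by
    have h1 := congrArg σc hu
    rw [map_mul, conj_conj, ← hu] at h1
    exact mul_right_cancel₀ h0 (by linear_combination h1)
  obtain ⟨n, hn, hun⟩ := exists_pow_eq_one_of_mul_conj huu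
  obtain ⟨r, rfl⟩ := exists_eq_neg_pow_of_pow_eq_one hp2 hζ hn hun
  -- `ζ ^ r` is a square, and the square root is spent on normalizing `α`
  obtain ⟨k, hk⟩ := (hp.odd_of_ne_two hp2).add_one
  have hzr : ζ ^ r = (ζ ^ (r * k)) ^ 2 := by
    calc ζ ^ r = ζ ^ r * (ζ ^ p) ^ r := by rw [hζ.pow_eq_one, one_pow, mul_one]
      _ = ζ ^ ((p + 1) * r) := by ring
      _ = (ζ ^ (r * k)) ^ 2 := by rw [hk]; ring
  have h1 : ζ ^ (r * k) * σc ζ ^ (r * k) = 1 := by rw [← mul_pow, mul_conj_eq_one hζ, one_pow]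
  refine ⟨r * k, ?_⟩
  rw [neg_pow, hzr] at hu
  rcases neg_one_pow_eq_or (𝓞 K) r with h2 | h2
  · left
    rw [h2] at hu
    rw [map_mul, map_pow, ← hu]
    linear_combination (ζ ^ (r * k) * α) * h1
  · right
    rw [h2] at hu
    rw [map_mul, map_pow, ← hu]
    linear_combination (-ζ ^ (r * k) * α) * h1

/-- The ideal class group of the maximal real subfield embeds into that of the cyclotomic field. If
the extension of a real ideal had a purely imaginary generator `α`, every real element of it would
be `α` times a purely imaginary integer; the latter is divisible by `ζ - 1`, since complex
conjugation is trivial modulo `ζ - 1` and `2` is invertible there. Hence the whole ideal would lie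
in `(α (ζ - 1))`. -/
theorem extendedHom_injective (hp2 : p ≠ 2) (hζ : IsPrimitiveRoot ζ p) :
    Function.Injective (ClassGroup.extendedHom (𝓞 (maximalRealSubfield K)) (𝓞 K)) := by
  have hp : p.Prime := Fact.out
  rw [injective_iff_map_eq_one]
  intro C hC
  obtain ⟨I, rfl⟩ := ClassGroup.mk0_surjective C
  rw [ClassGroup.extendedHom_mk0, ClassGroup.mk0_eq_one_iff] at hC
  set J : Ideal (𝓞 K) := I.1.map (algebraMap (𝓞 (maximalRealSubfield K)) (𝓞 K)) with hJ
  obtain ⟨α₀, hα₀'⟩ := hC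
  have hα₀ : J = Ideal.span {α₀} := hα₀'
  have hJ0 : J ≠ ⊥ := fun h ↦ nonZeroDivisors.ne_zero I.2
    ((Ideal.map_eq_bot_iff_of_injective (FaithfulSMul.algebraMap_injective _ _)).1 h)
  have h0 : α₀ ≠ 0 := by
    rintro rfl
    exact hJ0 (hα₀.trans (by simp))
  have hconjJ : J.map (σc : 𝓞 K →+* 𝓞 K) = J := by
    rw [hJ, Ideal.map_map]
    congr 1
    ext1 a
    exact (σc).commutes a
  have hspan : Ideal.span {σc α₀} = Ideal.span {α₀} := by
    have := hconjJ
    rw [hα₀, Ideal.map_span, Set.image_singleton] at this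
    exact this
  obtain ⟨s, hs⟩ := exists_root_mul_conj_eq_or hp2 hζ h0 hspan
  set α := α₀ * ζ ^ s with hα
  have hα0 : α ≠ 0 := mul_ne_zero h0 (pow_ne_zero _ (hζ.ne_zero hp.ne_zero))
  have hJα : J = Ideal.span {α} := by
    rw [hα₀, hα, Ideal.span_singleton_eq_span_singleton]
    exact (associated_mul_unit_right _ _ ((hζ.isUnit hp.ne_zero).pow s))
  rcases hs with hs | hs
  · obtain ⟨β, hβ⟩ := (IsCMField.ringOfIntegersComplexConj_eq_self_iff K α).1 hs
    refine (ClassGroup.mk0_eq_one_iff I.2).2 ⟨β, ?_⟩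
    rw [Ideal.submodule_span_eq,
      ← Ideal.comap_map_eq_self_of_faithfullyFlat (B := 𝓞 K) (Ideal.span {β}), Ideal.map_span,
      Set.image_singleton, hβ, ← hJα, hJ, Ideal.comap_map_eq_self_of_faithfullyFlat]
  · exfalso
    have hle : J ≤ Ideal.span {α * (ζ - 1)} := by
      rw [hJ, Ideal.map_le_iff_le_comap]
      intro b hb
      have hb' : algebraMap _ (𝓞 K) b ∈ Ideal.span {α} := hJα ▸ Ideal.mem_map_of_mem _ hb
      obtain ⟨x, hx⟩ := Ideal.mem_span_singleton'.1 hb'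
      have hxx : σc x = -x := by
        have h1 := (σc).commutes b
        rw [← hx, map_mul, hs] at h1
        exact mul_right_cancel₀ hα0 (by linear_combination -h1)
      have h2 : ζ - 1 ∣ x * (2 : ℤ) := by
        have := sub_one_dvd_conj_sub hζ x
        rw [hxx] at this
        rw [← dvd_neg]
        convert this using 1
        push_cast; ring
      rcases (zeta_sub_one_prime hζ).dvd_or_dvd h2 with h | h
      · rw [Ideal.mem_comap, ← hx, Ideal.mem_span_singleton, mul_comm x]
        exact mul_dvd_mul_left α h
      · have := dvd_of_zeta_sub_one_dvd_intCast hζ h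
        have h3 : p ∣ 2 := by exact_mod_cast this
        exact absurd ((Nat.prime_dvd_prime_iff_eq hp Nat.prime_two).1 h3) hp2
    have : α ∈ Ideal.span {α * (ζ - 1)} := hle (hJα ▸ Ideal.mem_span_singleton_self α)
    rw [Ideal.mem_span_singleton] at this
    nth_rw 2 [← mul_one α] at this
    exact (zeta_sub_one_prime hζ).not_isUnit
      (isUnit_of_dvd_one ((mul_dvd_mul_iff_left hα0).1 this))

/-- The only use of the class number hypothesis: an ideal class killed by `q` comes from the maximal
real subfield, so an ideal `𝔞` with `𝔞 ^ q` principal satisfies `a 𝔞 = σ a σ 𝔞` for a suitable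
`a`. Kronecker's theorem shows that the resulting unit is a root of unity. -/
theorem exists_mul_pow_eq_conj (hp2 : p ≠ 2) (hζ : IsPrimitiveRoot ζ p) {q : ℕ} (hq : q.Prime)
    (hclass : ¬ q ∣ relativeClassNumber K) {β : 𝓞 K} (hβ : β ≠ 0) {𝔞 : Ideal (𝓞 K)}
    (h𝔞 : Ideal.span {β} = 𝔞 ^ q) :
    ∃ a : 𝓞 K, a ≠ 0 ∧ ∃ r : ℕ, β * a ^ q = (-ζ) ^ r * (σc β * σc a ^ q) := by
  have h𝔞0 : 𝔞 ≠ 0 := by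
    rintro rfl
    rw [zero_pow hq.ne_zero, Ideal.zero_eq_bot, Ideal.span_singleton_eq_bot] at h𝔞
    exact hβ h𝔞
  have h𝔞m : 𝔞 ∈ (Ideal (𝓞 K))⁰ := mem_nonZeroDivisors_of_ne_zero h𝔞0
  have hpow : ClassGroup.mk0 ⟨𝔞, h𝔞m⟩ ^ q = 1 := by
    rw [← map_pow]
    exact (ClassGroup.mk0_eq_one_iff (pow_mem h𝔞m q)).2 ⟨β, h𝔞.symm⟩
  have hmem : ClassGroup.mk0 ⟨𝔞, h𝔞m⟩ ∈
      (ClassGroup.extendedHom (𝓞 (maximalRealSubfield K)) (𝓞 K)).range := by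
    refine Subgroup.mem_of_pow_eq_one_of_not_dvd_card_div _ hq ?_ hpow
    rwa [← Nat.card_congr (MonoidHom.ofInjective (extendedHom_injective hp2 hζ)).toEquiv,
      Nat.card_eq_fintype_card, Nat.card_eq_fintype_card]
  obtain ⟨C, hC⟩ := hmem
  obtain ⟨I, rfl⟩ := ClassGroup.mk0_surjective C
  rw [ClassGroup.extendedHom_mk0, eq_comm, ClassGroup.mk0_eq_mk0_iff] at hC
  obtain ⟨x, y, hx, hy, hxy⟩ := hC
  set J : Ideal (𝓞 K) := I.1.map (algebraMap (𝓞 (maximalRealSubfield K)) (𝓞 K)) with hJ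
  change Ideal.span {x} * 𝔞 = Ideal.span {y} * J at hxy
  have hconjJ : J.map (σc : 𝓞 K →+* 𝓞 K) = J := by
    rw [hJ, Ideal.map_map]
    congr 1
    ext1 a
    exact (σc).commutes a
  have hinj : ∀ a : 𝓞 K, a ≠ 0 → σc a ≠ 0 := fun a ha ↦ (map_ne_zero_iff _ (σc).injective).2 ha
  have hxy' : Ideal.span {σc x} * 𝔞.map (σc : 𝓞 K →+* 𝓞 K) = Ideal.span {σc y} * J := by
    have := congrArg (Ideal.map (σc : 𝓞 K →+* 𝓞 K)) hxy
    rw [Ideal.map_mul, Ideal.map_mul, hconjJ, Ideal.map_span, Ideal.map_span, Set.image_singleton,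
      Set.image_singleton] at this
    exact this
  have hβ' : Ideal.span {σc β} = (𝔞.map (σc : 𝓞 K →+* 𝓞 K)) ^ q := by
    rw [← Ideal.map_pow, ← h𝔞, Ideal.map_span, Set.image_singleton]
    rfl
  set a := x * σc y with ha
  have ha0 : a ≠ 0 := mul_ne_zero hx (hinj y hy)
  have hca : σc a = σc x * y := by rw [ha, map_mul, conj_conj]
  have hideal : Ideal.span {a} * 𝔞 = Ideal.span {σc a} * 𝔞.map (σc : 𝓞 K →+* 𝓞 K) := by
    rw [hca, ha, ← Ideal.span_singleton_mul_span_singleton,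
      ← Ideal.span_singleton_mul_span_singleton, mul_right_comm, hxy,
      mul_right_comm (Ideal.span {σc x}), hxy']
    ring
  have hass : Ideal.span {β * a ^ q} = Ideal.span {σc β * σc a ^ q} := by
    rw [← Ideal.span_singleton_mul_span_singleton, ← Ideal.span_singleton_mul_span_singleton,
      ← Ideal.span_singleton_pow, ← Ideal.span_singleton_pow, h𝔞, hβ', ← mul_pow, ← mul_pow,
      mul_comm 𝔞, hideal, mul_comm]
  obtain ⟨u, hu⟩ := Ideal.mem_span_singleton'.1
    (hass ▸ Ideal.mem_span_singleton_self (β * a ^ q) :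
      β * a ^ q ∈ Ideal.span {σc β * σc a ^ q})
  have huu : u * σc u = 1 := by
    have h1 := congrArg σc hu
    simp only [map_mul, map_pow, conj_conj] at h1
    rw [← hu] at h1
    refine mul_right_cancel₀ (mul_ne_zero (hinj β hβ) (pow_ne_zero q (hinj a ha0))) ?_
    linear_combination h1
  obtain ⟨n, hn, hun⟩ := exists_pow_eq_one_of_mul_conj huu
  obtain ⟨r, rfl⟩ := exists_eq_neg_pow_of_pow_eq_one hp2 hζ hn hun
  exact ⟨a, ha0, r, hu.symm⟩

end Cyclotomic

/-! ### The factorization of the equation into ideals -/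

section Descent

variable {p : ℕ} [Fact p.Prime] {K : Type*} [Field K] [NumberField K]
  [IsCyclotomicExtension {p} ℚ K] {ζ : 𝓞 K}

omit [NumberField K] [IsCyclotomicExtension {p} ℚ K] in
/-- Common divisors of two distinct factors of `x ^ p + y ^ p` divide `ζ - 1`. -/
theorem zeta_sub_one_mem_of_add_mul_mem (hζ : IsPrimitiveRoot ζ p) {x y : ℤ} (hxy : IsCoprime x y)
    {J : Ideal (𝓞 K)} {η₁ η₂ : 𝓞 K} (h₁ : η₁ ∈ Polynomial.nthRootsFinset p (1 : 𝓞 K))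
    (h₂ : η₂ ∈ Polynomial.nthRootsFinset p (1 : 𝓞 K)) (hne : η₁ ≠ η₂)
    (hm₁ : (x : 𝓞 K) + η₁ * y ∈ J) (hm₂ : (x : 𝓞 K) + η₂ * y ∈ J) : ζ - 1 ∈ J := by
  obtain ⟨u, v, huv⟩ := hxy
  have huv' : (u : 𝓞 K) * x + v * y = 1 := by exact_mod_cast congrArg (Int.cast : ℤ → 𝓞 K) huv
  have h : η₁ - η₂ ∈ J := by
    have : η₁ - η₂ = u * (η₁ * (x + η₂ * y) - η₂ * (x + η₁ * y)) +
        v * ((x + η₁ * y) - (x + η₂ * y)) := by linear_combination -(η₁ - η₂) * huv'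
    rw [this]
    exact J.add_mem (J.mul_mem_left _ (J.sub_mem (J.mul_mem_left _ hm₂) (J.mul_mem_left _ hm₁)))
      (J.mul_mem_left _ (J.sub_mem hm₁ hm₂))
  obtain ⟨w, hw⟩ :=
    (hζ.nthRootsFinset_pairwise_associated_sub_one_sub_of_prime Fact.out h₁ h₂ hne).symm
  rw [← hw]
  exact J.mul_mem_right _ h

theorem one_mem_of_zeta_sub_one_mem (hζ : IsPrimitiveRoot ζ p) {J : Ideal (𝓞 K)}
    (h : ζ - 1 ∈ J) {n : ℤ} (hn : ¬ (p : ℤ) ∣ n) (hnJ : (n : 𝓞 K) ∈ J) : (1 : 𝓞 K) ∈ J := by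
  have hp : p.Prime := Fact.out
  obtain ⟨u, v, huv⟩ := (Nat.prime_iff_prime_int.1 hp).coprime_iff_not_dvd.2 hn
  have huv' : (u : 𝓞 K) * p + v * n = 1 := by exact_mod_cast congrArg (Int.cast : ℤ → 𝓞 K) huv
  rw [← huv']
  exact J.add_mem (J.mul_mem_left _ (J.mem_of_dvd (zeta_sub_one_dvd_prime hζ) h))
    (J.mul_mem_left _ hnJ)

theorem isCoprime_of_one_mem_span_pair {R : Type*} [CommRing R] {a b : R}
    (h : (1 : R) ∈ Ideal.span {a, b}) : IsCoprime (Ideal.span {a}) (Ideal.span {b}) := by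
  rw [Ideal.isCoprime_span_singleton_iff]
  exact Ideal.mem_span_pair.1 h

/-- The ideal of `x + ζ y` is a `q`-th power, up to one factor `1 - ζ` when `p` divides `z`. In that
case the conjugates `x + η y` are divided by `1 - η`, and the removed factors are attached to the
factor `x + y`; the new factors are still pairwise coprime since each quotient is congruent to `-y`
modulo `1 - ζ`. -/
theorem exists_span_eq_pow (hp2 : p ≠ 2) (hζ : IsPrimitiveRoot ζ p) {q : ℕ} {x y z : ℤ}
    (hq : q ≠ 0) (hxy : IsCoprime x y) (h : x ^ p + y ^ p = z ^ q) :
    ∃ (β : 𝓞 K) (𝔞 : Ideal (𝓞 K)), Ideal.span {β} = 𝔞 ^ q ∧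
      ((x : 𝓞 K) + ζ * y = β ∨ (x : 𝓞 K) + ζ * y = (1 - ζ) * β) := by
  classical
  have hp : p.Prime := Fact.out
  set S := Polynomial.nthRootsFinset p (1 : 𝓞 K) with hS
  have hζS : ζ ∈ S := (Polynomial.mem_nthRootsFinset hp.pos 1).2 hζ.pow_eq_one
  have h1S : (1 : 𝓞 K) ∈ S := (Polynomial.mem_nthRootsFinset hp.pos 1).2 (one_pow p)
  have hprod : ∏ η ∈ S, ((x : 𝓞 K) + η * y) = (z : 𝓞 K) ^ q := by
    rw [← IsPrimitiveRoot.pow_add_pow_eq_prod_add_mul (x : 𝓞 K) y (hp.odd_of_ne_two hp2) hζ]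
    exact_mod_cast congrArg (Int.cast : ℤ → 𝓞 K) h
  by_cases hpz : (p : ℤ) ∣ z
  · have hxyp : (p : ℤ) ∣ x + y := by
      have h1 : ((x + y : ℤ) : ZMod p) = 0 := by
        have h2 := congrArg (Int.cast : ℤ → ZMod p) h
        push_cast at h2 ⊢
        rwa [ZMod.pow_card, ZMod.pow_card, (ZMod.intCast_zmod_eq_zero_iff_dvd z p).2 hpz,
          zero_pow hq] at h2
      exact (ZMod.intCast_zmod_eq_zero_iff_dvd _ _).1 h1
    have hpy : ¬ (p : ℤ) ∣ y := fun hy ↦ (Nat.prime_iff_prime_int.1 hp).not_isUnit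
      (hxy.isUnit_of_dvd' ((dvd_add_left hy).1 hxyp) hy)
    obtain ⟨k, hk⟩ := hxyp
    have hk' : (x : 𝓞 K) + y = p * k := by exact_mod_cast congrArg (Int.cast : ℤ → 𝓞 K) hk
    have hass : ∀ η ∈ S, η ≠ 1 → Associated (ζ - 1) (1 - η) := fun η hη hne ↦
      hζ.nthRootsFinset_pairwise_associated_sub_one_sub_of_prime hp h1S hη hne.symm
    have hsq : (ζ - 1) ^ 2 ∣ (p : 𝓞 K) := by
      have hζ' : IsPrimitiveRoot (ζ : K) p := hζ.map_of_injective RingOfIntegers.coe_injective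
      refine dvd_trans (pow_dvd_pow _ ?_)
        (IsCyclotomicExtension.Rat.associated_zeta_sub_one_pow_prime p hζ').dvd
      have := lt_of_le_of_ne hp.two_le (Ne.symm hp2)
      lia
    have hex : ∀ η : 𝓞 K, ∃ b : 𝓞 K, η ∈ S → η ≠ 1 →
        (x : 𝓞 K) + η * y = (1 - η) * b ∧ ζ - 1 ∣ b + y := by
      intro η
      by_cases hη : η ∈ S ∧ η ≠ 1
      · obtain ⟨t, ht⟩ := hsq
        obtain ⟨w, hw⟩ := (hass η hη.1 hη.2).dvd'
        refine ⟨w * (ζ - 1) * t * k - y, fun _ _ ↦ ⟨?_, ?_⟩⟩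
        · have : (x : 𝓞 K) = p * k - y := by linear_combination hk'
          rw [this, ht]
          linear_combination ((ζ - 1) * t * k) * hw
        · exact ⟨w * t * k, by ring⟩
      · exact ⟨0, fun h1 h2 ↦ absurd ⟨h1, h2⟩ hη⟩
    choose b hb using hex
    set B : 𝓞 K → 𝓞 K := fun η ↦ if η = 1 then
      (∏ η' ∈ S.erase 1, (1 - η')) * ((x : 𝓞 K) + y) else b η with hB
    have hprodB : ∏ η ∈ S, B η = (z : 𝓞 K) ^ q := by
      rw [← hprod, ← Finset.mul_prod_erase S _ h1S, ← Finset.mul_prod_erase S _ h1S, hB]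
      simp only [if_true, one_mul]
      rw [mul_comm (∏ _ ∈ _, _) ((x : 𝓞 K) + y), mul_assoc, ← Finset.prod_mul_distrib]
      congr 1
      refine Finset.prod_congr rfl fun η hη ↦ ?_
      rw [Finset.mem_erase] at hη
      rw [if_neg hη.1, (hb η hη.2 hη.1).1]
    have hcop1 : ∀ η ∈ S, η ≠ 1 → IsCoprime (Ideal.span {b η}) (Ideal.span {B 1}) := by
      intro η hη hne
      have hmem : ∀ J : Ideal (𝓞 K), b η ∈ J → ζ - 1 ∈ J → (1 : 𝓞 K) ∈ J := by
        intro J h1 h2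
        refine one_mem_of_zeta_sub_one_mem hζ h2 hpy ?_
        have := J.sub_mem (J.mem_of_dvd (hb η hη hne).2 h2) h1
        rwa [add_sub_cancel_left] at this
      rw [Ideal.isCoprime_span_singleton_iff, hB]
      simp only [if_true]
      refine IsCoprime.mul_right (IsCoprime.prod_right fun η' hη' ↦ ?_) ?_
      · rw [Finset.mem_erase] at hη'
        refine Ideal.mem_span_pair.1 (hmem _ (Ideal.subset_span (by simp)) ?_)
        exact Ideal.mem_of_dvd _ (hass η' hη'.2 hη'.1).dvd' (Ideal.subset_span (by simp))
      · refine Ideal.mem_span_pair.1 (hmem _ (Ideal.subset_span (by simp)) ?_)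
        refine zeta_sub_one_mem_of_add_mul_mem hζ hxy hη h1S hne ?_ ?_
        · rw [(hb η hη hne).1]
          exact Ideal.mul_mem_left _ _ (Ideal.subset_span (by simp))
        · rw [one_mul]
          exact Ideal.subset_span (by simp)
    have hcop : ∀ η ∈ S, ∀ η' ∈ S, η ≠ η' →
        IsCoprime (Ideal.span {B η}) (Ideal.span {B η'}) := by
      intro η hη η' hη' hne
      by_cases h1 : η = 1
      · subst h1
        have := hcop1 η' hη' hne.symm
        have h2 : B η' = b η' := if_neg hne.symm
        rw [h2]
        exact this.symm
      by_cases h2 : η' = 1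
      · subst h2
        have h2 : B η = b η := if_neg h1
        rw [h2]
        exact hcop1 η hη h1
      rw [show B η = b η from if_neg h1, show B η' = b η' from if_neg h2]
      refine isCoprime_of_one_mem_span_pair ?_
      have hπ : ζ - 1 ∈ Ideal.span {b η, b η'} := by
        refine zeta_sub_one_mem_of_add_mul_mem hζ hxy hη hη' hne ?_ ?_
        · rw [(hb η hη h1).1]
          exact Ideal.mul_mem_left _ _ (Ideal.subset_span (by simp))
        · rw [(hb η' hη' h2).1]
          exact Ideal.mul_mem_left _ _ (Ideal.subset_span (by simp))
      refine one_mem_of_zeta_sub_one_mem hζ hπ hpy ?_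
      have := Ideal.sub_mem _ (Ideal.mem_of_dvd _ (hb η hη h1).2 hπ)
        (Ideal.subset_span (by simp) : b η ∈ Ideal.span {b η, b η'})
      rwa [add_sub_cancel_left] at this
    have hζ1 : ζ ≠ 1 := hζ.ne_one hp.one_lt
    obtain ⟨𝔞, h𝔞⟩ := Finset.exists_eq_pow_of_mul_eq_pow_of_coprime hcop
      (c := Ideal.span {(z : 𝓞 K)}) (n := q)
      (by rw [Ideal.prod_span_singleton, hprodB, Ideal.span_singleton_pow]) ζ hζS
    rw [show B ζ = b ζ from if_neg hζ1] at h𝔞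
    exact ⟨b ζ, 𝔞, h𝔞, Or.inr (hb ζ hζS hζ1).1⟩
  · have hcop : ∀ η ∈ S, ∀ η' ∈ S, η ≠ η' → IsCoprime (Ideal.span {(x : 𝓞 K) + η * y})
        (Ideal.span {(x : 𝓞 K) + η' * y}) := by
      intro η hη η' hη' hne
      refine isCoprime_of_one_mem_span_pair ?_
      have hπ := zeta_sub_one_mem_of_add_mul_mem hζ hxy hη hη' hne
        (J := Ideal.span {(x : 𝓞 K) + η * y, (x : 𝓞 K) + η' * y})
        (Ideal.subset_span (by simp)) (Ideal.subset_span (by simp))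
      refine one_mem_of_zeta_sub_one_mem hζ hπ (n := z ^ q)
        (fun h ↦ hpz ((Nat.prime_iff_prime_int.1 hp).dvd_of_dvd_pow h)) ?_
      rw [Int.cast_pow, ← hprod]
      exact Ideal.mem_of_dvd _ (Finset.dvd_prod_of_mem _ hη) (Ideal.subset_span (by simp))
    obtain ⟨𝔞, h𝔞⟩ := Finset.exists_eq_pow_of_mul_eq_pow_of_coprime hcop
      (c := Ideal.span {(z : 𝓞 K)}) (n := q)
      (by rw [Ideal.prod_span_singleton, hprod, Ideal.span_singleton_pow]) ζ hζS
    exact ⟨_, 𝔞, h𝔞, Or.inl rfl⟩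

variable [IsCMField K]

local notation "σc" => IsCMField.ringOfIntegersComplexConj K

omit [IsCyclotomicExtension {p} ℚ K] [IsCMField K] in
theorem add_zeta_mul_ne_zero (hp2 : p ≠ 2) (hζ : IsPrimitiveRoot ζ p) {x y : ℤ}
    (hxy : x ^ p + y ^ p ≠ 0) : (x : 𝓞 K) + ζ * y ≠ 0 := by
  have hp : p.Prime := Fact.out
  intro h0
  have h1 : ((x ^ p + y ^ p : ℤ) : 𝓞 K) = 0 := by
    push_cast
    rw [IsPrimitiveRoot.pow_add_pow_eq_prod_add_mul _ _ (hp.odd_of_ne_two hp2) hζ]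
    exact Finset.prod_eq_zero ((Polynomial.mem_nthRootsFinset hp.pos 1).2 hζ.pow_eq_one) h0
  exact hxy (by exact_mod_cast h1)

/-- Up to a root of unity, `(x + ζ y) / σ (x + ζ y)` is the `q`-th power of `σ a / a`. -/
theorem exists_add_zeta_mul_pow_eq (hp2 : p ≠ 2) (hζ : IsPrimitiveRoot ζ p) {q : ℕ} (hq : q.Prime)
    (hclass : ¬ q ∣ relativeClassNumber K) {x y z : ℤ} (hxy : IsCoprime x y) (hz : z ≠ 0)
    (h : x ^ p + y ^ p = z ^ q) :
    ∃ a : 𝓞 K, a ≠ 0 ∧ ∃ r : ℕ, ((x : 𝓞 K) + ζ * y) * a ^ q =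
      (-ζ) ^ r * (σc ((x : 𝓞 K) + ζ * y) * σc a ^ q) := by
  have hα0 : (x : 𝓞 K) + ζ * y ≠ 0 :=
    add_zeta_mul_ne_zero hp2 hζ (by rw [h]; exact pow_ne_zero _ hz)
  obtain ⟨β, 𝔞, h𝔞, hβ⟩ := exists_span_eq_pow (K := K) hp2 hζ hq.ne_zero hxy h
  have hβ0 : β ≠ 0 := by
    rintro rfl
    rcases hβ with h | h
    · exact hα0 h
    · exact hα0 (by rw [h, mul_zero])
  obtain ⟨a, ha, r, hr⟩ := exists_mul_pow_eq_conj hp2 hζ hq hclass hβ0 h𝔞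
  refine ⟨a, ha, ?_⟩
  rcases hβ with hβ | hβ
  · exact ⟨r, by rw [hβ, hr]⟩
  · refine ⟨r + 1, ?_⟩
    rw [hβ, mul_assoc, hr, map_mul, map_sub, map_one]
    linear_combination (-(-ζ) ^ r * σc β * σc a ^ q) * mul_conj_eq_one hζ

end Descent

/-! ### Linear independence of roots of unity modulo a prime -/

section Independence

variable {p : ℕ} [Fact p.Prime] {K : Type*} [Field K] [NumberField K]
  [IsCyclotomicExtension {p} ℚ K] {ζ : 𝓞 K}

open Polynomial in
/-- The `p`-th roots of unity satisfy no linear relation modulo `q` besides the vanishing of their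
sum: the coefficients of any relation, collected by residue classes modulo `p`, are all equal. -/
theorem class_sums_modEq_of_dvd_sum (hζ : IsPrimitiveRoot ζ p) {ι : Type*} (S : Finset ι)
    (n : ι → ℕ) (c : ι → ℤ) (q : ℕ) (h : (q : 𝓞 K) ∣ ∑ i ∈ S, (c i : 𝓞 K) * ζ ^ n i)
    (m m' : ZMod p) :
    ∑ i ∈ S with (n i : ZMod p) = m, c i ≡ ∑ i ∈ S with (n i : ZMod p) = m', c i [ZMOD q] := by
  have hp : p.Prime := Fact.out
  set C' : ZMod p → ℤ := fun m ↦ ∑ i ∈ S with (n i : ZMod p) = m, c i with hC'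
  set P : ℤ[X] := ∑ k : ZMod p, C (C' k) * X ^ k.val with hP
  have hPval : aeval ζ P = ∑ i ∈ S, (c i : 𝓞 K) * ζ ^ n i := by
    rw [hP, map_sum, ← Finset.sum_fiberwise S (fun i ↦ (n i : ZMod p))]
    refine Finset.sum_congr rfl fun k _ ↦ ?_
    rw [map_mul, aeval_C, map_pow, aeval_X, hC', map_sum, Finset.sum_mul]
    refine Finset.sum_congr rfl fun i hi ↦ ?_
    rw [Finset.mem_filter] at hi
    rw [← hi.2, ZMod.val_natCast, ← pow_eq_pow_mod _ hζ.pow_eq_one]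
    simp
  obtain ⟨w, hw⟩ := h
  obtain ⟨g, rfl⟩ := exists_aeval_eq hζ w
  have h0 : aeval ζ (P - C (q : ℤ) * g) = 0 := by
    rw [map_sub, hPval, hw, map_mul, aeval_C]
    simp
  have hdvd : cyclotomic p ℤ ∣ P - C (q : ℤ) * g := by
    have hζ' : IsPrimitiveRoot (ζ : K) p := hζ.map_of_injective RingOfIntegers.coe_injective
    rw [cyclotomic_eq_minpoly hζ' hp.pos]
    refine minpoly.isIntegrallyClosed_dvd (hζ'.isIntegral hp.pos) ?_
    rw [aeval_algebraMap_apply, h0, map_zero]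
  obtain ⟨G, hG⟩ := Polynomial.map_dvd (Int.castRingHom (ZMod q)) hdvd
  have hG' : P.map (Int.castRingHom (ZMod q)) = cyclotomic p (ZMod q) * G := by
    rw [map_cyclotomic, Polynomial.map_sub, Polynomial.map_mul, Polynomial.map_C] at hG
    simpa using hG
  have hdeg : (P.map (Int.castRingHom (ZMod q))).natDegree ≤ p - 1 := by
    refine natDegree_map_le.trans (natDegree_sum_le_of_forall_le _ _ fun k _ ↦ ?_)
    refine (natDegree_C_mul_X_pow_le _ _).trans ?_
    have := ZMod.val_lt k
    lia
  have hGdeg : G.natDegree = 0 := by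
    by_cases hG0 : G = 0
    · rw [hG0, natDegree_zero]
    · have hne : Nontrivial (ZMod q) := (nontrivial_iff.1 ⟨G, 0, hG0⟩)
      rw [hG', (cyclotomic.monic p (ZMod q)).natDegree_mul' hG0, natDegree_cyclotomic,
        Nat.totient_prime hp] at hdeg
      lia
  rw [eq_C_of_natDegree_eq_zero hGdeg, cyclotomic_prime] at hG'
  have hcoeff : ∀ k : ZMod p, ((C' k : ℤ) : ZMod q) = G.coeff 0 := by
    intro k
    have h1 := congrArg (fun f : (ZMod q)[X] ↦ f.coeff k.val) hG'
    have h2 : P.coeff k.val = C' k := by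
      rw [hP, finsetSum_coeff, Finset.sum_eq_single k]
      · simp
      · intro b _ hb
        rw [coeff_C_mul, coeff_X_pow, if_neg, mul_zero]
        exact fun e ↦ hb (ZMod.val_injective p e).symm
      · simp
    simp only [coeff_map, h2, coeff_mul_C, finsetSum_coeff, coeff_X_pow] at h1
    rw [Finset.sum_eq_single k.val (fun b _ hb ↦ if_neg hb.symm)
      (fun h ↦ absurd (Finset.mem_range.2 (ZMod.val_lt k)) h), if_pos rfl, one_mul] at h1
    exact h1
  rw [← ZMod.intCast_eq_intCast_iff]
  exact (hcoeff m).trans (hcoeff m').symm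

theorem class_sums_modEq_neg_of_dvd_sum (hζ : IsPrimitiveRoot ζ p) (e : ℕ → ℤ) (q : ℕ)
    (h : (q : 𝓞 K) ∣ ∑ j ∈ Finset.Icc 1 q, (e j : 𝓞 K) * (ζ ^ j - (ζ ^ (p - 1)) ^ j)) (m : ℤ) :
    ∑ j ∈ (Finset.Icc 1 q).filter (fun j : ℕ ↦ (j : ℤ) ≡ m [ZMOD p]), e j ≡
      ∑ j ∈ (Finset.Icc 1 q).filter (fun j : ℕ ↦ (j : ℤ) ≡ -m [ZMOD p]), e j [ZMOD q] := by
  have hp : p.Prime := Fact.out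
  have h1 := class_sums_modEq_of_dvd_sum hζ ((Finset.Icc 1 q).disjSum (Finset.Icc 1 q))
    (Sum.elim (fun j ↦ j) (fun j ↦ (p - 1) * j)) (Sum.elim (fun j ↦ e j) (fun j ↦ -e j)) q (by
      rw [Finset.sum_disjSum, ← Finset.sum_add_distrib]
      convert h using 2 with j
      simp only [Sum.elim_inl, Sum.elim_inr, Int.cast_neg, pow_mul]
      ring) (m : ZMod p) 0
  have hcast : ∀ j : ℕ, (((p - 1) * j : ℕ) : ZMod p) = -(j : ZMod p) := by
    intro j
    rw [Nat.cast_mul, Nat.cast_sub hp.one_le]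
    simp
  have key : ∀ k : ZMod p, ∑ i ∈ ((Finset.Icc 1 q).disjSum (Finset.Icc 1 q)).filter
        (fun i ↦ ((Sum.elim (fun j ↦ j) (fun j ↦ (p - 1) * j) i : ℕ) : ZMod p) = k),
        (Sum.elim (fun j ↦ e j) (fun j ↦ -e j) i : ℤ) =
      ∑ j ∈ (Finset.Icc 1 q).filter (fun j : ℕ ↦ (j : ZMod p) = k), e j -
        ∑ j ∈ (Finset.Icc 1 q).filter (fun j : ℕ ↦ -(j : ZMod p) = k), e j := by
    intro k
    rw [Finset.sum_filter, Finset.sum_disjSum, sub_eq_add_neg, ← Finset.sum_neg_distrib,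
      Finset.sum_filter, Finset.sum_filter]
    congr 1
    refine Finset.sum_congr rfl fun j _ ↦ ?_
    exact if_congr (by simp only [Sum.elim_inr, hcast]) rfl rfl
  rw [key, key, Finset.filter_congr (fun (j : ℕ) _ ↦ neg_eq_zero (a := (j : ZMod p))),
    sub_self] at h1
  rw [Finset.filter_congr (fun (j : ℕ) _ ↦
      show (j : ℤ) ≡ m [ZMOD p] ↔ (j : ZMod p) = (m : ZMod p) by
        rw [← ZMod.intCast_eq_intCast_iff, Int.cast_natCast]),
    Finset.filter_congr (fun (j : ℕ) _ ↦
      show (j : ℤ) ≡ -m [ZMOD p] ↔ -(j : ZMod p) = (m : ZMod p) by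
        rw [← ZMod.intCast_eq_intCast_iff, Int.cast_natCast, Int.cast_neg, neg_eq_iff_eq_neg])]
  have := h1.add_right (∑ j ∈ (Finset.Icc 1 q).filter (fun j : ℕ ↦ -(j : ZMod p) = m), e j)
  rwa [sub_add_cancel, zero_add] at this

end Independence

/-- Up to sign, `s ↦ t = s⁻¹` preserves the left-hand side, which is why the differences
`s ^ j - t ^ j` appear. The summands with `j = 0` cancel. -/
theorem add_mul_pow_mul_sub_eq_sum {R : Type*} [CommRing R] (x y s t : R) (hst : s * t = 1)
    (q : ℕ) :
    (x + t * y) ^ q * (x + s ^ q * y) - (x + t ^ q * y) * (x + s * y) ^ q =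
      ∑ j ∈ Finset.Icc 1 q, (q.choose j : R) *
        (x ^ j * y ^ (q + 1 - j) - x ^ (q + 1 - j) * y ^ j) * (s ^ j - t ^ j) := by
  have aux : ∀ s t : R, s * t = 1 → (x + t * y) ^ q * (x + s ^ q * y) =
      ∑ j ∈ Finset.range (q + 1), (q.choose j : R) *
        (x ^ (q + 1 - j) * y ^ j * t ^ j + x ^ j * y ^ (q + 1 - j) * s ^ j) := by
    intro s t hst
    have h1 : (x + t * y) ^ q * x = ∑ j ∈ Finset.range (q + 1),
        (q.choose j : R) * (x ^ (q + 1 - j) * y ^ j * t ^ j) := by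
      rw [add_comm x, add_pow, Finset.sum_mul]
      refine Finset.sum_congr rfl fun j hj ↦ ?_
      rw [Finset.mem_range] at hj
      rw [show q + 1 - j = (q - j) + 1 by lia]
      ring
    have h2 : (x + t * y) ^ q * (s ^ q * y) = ∑ j ∈ Finset.range (q + 1),
        (q.choose j : R) * (x ^ j * y ^ (q + 1 - j) * s ^ j) := by
      rw [add_pow, Finset.sum_mul]
      refine Finset.sum_congr rfl fun j hj ↦ ?_
      rw [Finset.mem_range] at hj
      have h3 : s ^ q = s ^ j * s ^ (q - j) := by rw [← pow_add]; congr 1; lia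
      have h4 : s ^ (q - j) * t ^ (q - j) = 1 := by rw [← mul_pow, hst, one_pow]
      rw [show q + 1 - j = (q - j) + 1 by lia, h3, mul_pow]
      linear_combination (x ^ j * y ^ (q - j) * y * q.choose j * s ^ j) * h4
    rw [mul_add, h1, h2, ← Finset.sum_add_distrib]
    refine Finset.sum_congr rfl fun j _ ↦ ?_
    ring
  rw [aux s t hst, mul_comm (x + t ^ q * y), aux t s (by rw [mul_comm, hst]),
    ← Finset.sum_sub_distrib, Finset.range_eq_Ico, Finset.sum_eq_sum_Ico_succ_bot (by lia)]
  simp only [pow_zero, mul_one]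
  rw [sub_self, zero_add]
  refine Finset.sum_congr (by ext; simp) fun j _ ↦ ?_
  ring

/-! ### The Frobenius congruence -/

open Polynomial in
/-- Frobenius congruence for integral polynomials. -/
theorem prime_dvd_aeval_pow_sub {R : Type*} [CommRing R] {q : ℕ} (hq : q.Prime) (s : R)
    (f : ℤ[X]) : (q : R) ∣ aeval s f ^ q - aeval (s ^ q) f := by
  have : Fact q.Prime := ⟨hq⟩
  have h : C (q : ℤ) ∣ f ^ q - expand ℤ q f := by
    rw [C_dvd_iff_dvd_coeff]
    intro i
    rw [← ZMod.intCast_zmod_eq_zero_iff_dvd]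
    have h1 : (f ^ q - expand ℤ q f).map (Int.castRingHom (ZMod q)) = 0 := by
      rw [Polynomial.map_sub, Polynomial.map_pow, map_expand, ZMod.expand_card, sub_self]
    have h2 := congrArg (fun g ↦ coeff g i) h1
    rwa [coeff_map, coeff_zero] at h2
  obtain ⟨g, hg⟩ := h
  refine ⟨aeval s g, ?_⟩
  have := congrArg (aeval s) hg
  simpa [expand_aeval] using this

section Local

variable {p : ℕ} [Fact p.Prime] {K : Type*} [Field K] [NumberField K]
  [IsCyclotomicExtension {p} ℚ K] {ζ : 𝓞 K}

/-- The Frobenius automorphism at `q`, as a ring endomorphism. -/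
theorem exists_ringHom_zeta_eq_pow (hζ : IsPrimitiveRoot ζ p) {q : ℕ} (hqp : q.Coprime p) :
    ∃ F : 𝓞 K →+* 𝓞 K, F ζ = ζ ^ q := by
  have hp : p.Prime := Fact.out
  let σ := (IsCyclotomicExtension.Rat.galEquivZMod p K).symm (ZMod.unitOfCoprime q hqp)
  refine ⟨(RingOfIntegers.mapRingEquiv σ.toRingEquiv : 𝓞 K →+* 𝓞 K), ?_⟩
  apply RingOfIntegers.coe_injective
  have h := IsCyclotomicExtension.Rat.galEquivZMod_apply_of_pow_eq p K σ (x := (ζ : K))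
    (by rw [← map_pow, hζ.pow_eq_one, map_one])
  rw [MulEquiv.apply_symm_apply, ZMod.coe_unitOfCoprime, ZMod.val_natCast,
    ← pow_eq_pow_mod _ (by rw [← map_pow, hζ.pow_eq_one, map_one])] at h
  rw [map_pow]
  exact h

theorem prime_dvd_pow_sub_map (hζ : IsPrimitiveRoot ζ p) {q : ℕ} (hq : q.Prime)
    (F : 𝓞 K →+* 𝓞 K) (hF : F ζ = ζ ^ q) (a : 𝓞 K) : (q : 𝓞 K) ∣ a ^ q - F a := by
  obtain ⟨f, rfl⟩ := exists_aeval_eq hζ a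
  have h : F (Polynomial.aeval ζ f) = Polynomial.aeval (F ζ) f :=
    (Polynomial.aeval_algHom_apply F.toIntAlgHom ζ f).symm
  rw [h, hF]
  exact prime_dvd_aeval_pow_sub hq ζ f

variable [IsCMField K]

local notation "σc" => IsCMField.ringOfIntegersComplexConj K

/-- A `q`-th root of `α / σ α`, up to units, becomes integral after multiplication by `σ α`. -/
theorem exists_mul_pow_eq_conj_pow_mul {q : ℕ} (hq : 1 ≤ q) {α a w : 𝓞 K} (ha : a ≠ 0)
    (hw : IsUnit w) (h : α * a ^ q = w * (σc α * σc a ^ q)) :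
    ∃ μ : 𝓞 K, w * μ ^ q = σc α ^ (q - 1) * α := by
  obtain ⟨w', hw'⟩ := hw.exists_right_inv
  have ha' : algebraMap (𝓞 K) K a ≠ 0 := RingOfIntegers.coe_ne_zero_iff.2 ha
  have h1 : σc α ^ q * σc a ^ q = (w' * (σc α ^ (q - 1) * α)) * a ^ q := by
    obtain ⟨n, rfl⟩ : ∃ n, q = n + 1 := ⟨q - 1, by lia⟩
    rw [Nat.add_sub_cancel]
    linear_combination (-w' * σc α ^ n) * h - (σc α ^ (n + 1) * σc a ^ (n + 1)) * hw'
  set m : K := algebraMap (𝓞 K) K (σc α) * algebraMap (𝓞 K) K (σc a) / algebraMap (𝓞 K) K a with hm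
  have hmq : m ^ q = algebraMap (𝓞 K) K (w' * (σc α ^ (q - 1) * α)) := by
    rw [hm, div_pow, div_eq_iff (pow_ne_zero _ ha'), mul_pow]
    have h2 := congrArg (algebraMap (𝓞 K) K) h1
    rwa [map_mul (algebraMap (𝓞 K) K), map_pow (algebraMap (𝓞 K) K), map_pow (algebraMap (𝓞 K) K),
      map_mul (algebraMap (𝓞 K) K) _ (a ^ q), map_pow (algebraMap (𝓞 K) K) a] at h2
  have hint : IsIntegral ℤ m := by
    refine IsIntegral.of_pow hq ?_
    rw [hmq]
    exact RingOfIntegers.isIntegral_coe _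
  obtain ⟨μ, hμ⟩ := (IsIntegralClosure.isIntegral_iff (A := 𝓞 K)).1 hint
  have hμq : μ ^ q = w' * (σc α ^ (q - 1) * α) :=
    RingOfIntegers.coe_injective (by rw [map_pow, hμ, hmq])
  exact ⟨μ, by rw [hμq, ← mul_assoc, hw', one_mul]⟩

omit [NumberField K] [IsCyclotomicExtension {p} ℚ K] [IsCMField K] in
/-- Roots of unity of `K` are `q`-th powers when `q` is prime to `2 p`. -/
theorem exists_neg_zeta_pow_eq_pow {q : ℕ} (hζ : IsPrimitiveRoot ζ p) (hq : q.Coprime (2 * p))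
    (r : ℕ) : ∃ v : 𝓞 K, (-ζ) ^ r = v ^ q := by
  have hp : p.Prime := Fact.out
  have h1 : (-ζ) ^ (2 * p) = 1 := by
    rw [pow_mul, neg_sq, ← pow_mul, mul_comm, pow_mul, hζ.pow_eq_one, one_pow]
  obtain ⟨m, hm⟩ := Nat.exists_mul_mod_eq_one_of_coprime hq (by have := hp.one_lt; lia)
  refine ⟨(-ζ) ^ (m * r), ?_⟩
  rw [← pow_mul, show m * r * q = q * m * r by ring, pow_mul _ (q * m),
    pow_eq_pow_mod (q * m) h1, hm.2, pow_one]

/-- Let `A = x + ζ y` and `B = σ A`, and write `A'`, `B'` for their images under the Frobenius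
automorphism `F` at `q`. Up to a `q`-th power of a root of unity `B ^ (q - 1) * A = μ ^ q` is a
`q`-th power. Since `F` is the `q`-th power modulo `q`, the equation `F (μ) ^ q = B' ^ (q - 1) * A'`
becomes a congruence modulo `q ^ 2`, namely `B' ^ (q - 1) * (B ^ q * A' - B' * A ^ q) ≡ 0`. The
second factor is a sum of `ζ ^ j - ζ ^ (-j)` with coefficients `q * e j`, and the first can be
cancelled. -/
theorem class_sums_modEq_neg {q : ℕ} {x y z : ℤ} (hp2 : p ≠ 2) (hq : q.Prime) (hq2 : q ≠ 2)
    (hpq : p ≠ q) (hζ : IsPrimitiveRoot ζ p) (hclass : ¬ q ∣ relativeClassNumber K)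
    (hxy : IsCoprime x y) (hz : z ≠ 0) (h : x ^ p + y ^ p = z ^ q) {e : ℕ → ℤ}
    (he : ∀ j, 1 ≤ j → j ≤ q →
      (q : ℤ) * e j = q.choose j * (x ^ j * y ^ (q + 1 - j) - x ^ (q + 1 - j) * y ^ j)) (m : ℤ) :
    ∑ j ∈ (Finset.Icc 1 q).filter (fun j : ℕ ↦ (j : ℤ) ≡ m [ZMOD p]), e j ≡
      ∑ j ∈ (Finset.Icc 1 q).filter (fun j : ℕ ↦ (j : ℤ) ≡ -m [ZMOD p]), e j [ZMOD q] := by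
  have hp : p.Prime := Fact.out
  have hqp : q.Coprime p := (Nat.coprime_primes hq hp).2 hpq.symm
  have hq0 : (q : 𝓞 K) ≠ 0 := Nat.cast_ne_zero.2 hq.ne_zero
  refine class_sums_modEq_neg_of_dvd_sum hζ e q ?_ m
  set E : 𝓞 K := ∑ j ∈ Finset.Icc 1 q, (e j : 𝓞 K) * (ζ ^ j - (ζ ^ (p - 1)) ^ j) with hE
  obtain ⟨a, ha, r, hr⟩ := exists_add_zeta_mul_pow_eq hp2 hζ hq hclass hxy hz h
  obtain ⟨v, hv⟩ := exists_neg_zeta_pow_eq_pow hζ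
    (Nat.Coprime.mul_right ((Nat.coprime_primes hq Nat.prime_two).2 hq2) hqp) r
  obtain ⟨μ₀, hμ₀⟩ := exists_mul_pow_eq_conj_pow_mul hq.one_le ha
    ((hζ.isUnit hp.ne_zero).neg.pow r) hr
  obtain ⟨μ, hμ⟩ : ∃ μ : 𝓞 K, μ ^ q =
      σc ((x : 𝓞 K) + ζ * y) ^ (q - 1) * ((x : 𝓞 K) + ζ * y) :=
    ⟨v * μ₀, by rw [mul_pow, ← hv, hμ₀]⟩
  obtain ⟨F, hF⟩ := exists_ringHom_zeta_eq_pow hζ hqp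
  set ζ' : 𝓞 K := ζ ^ (p - 1) with hζ'
  have hζζ' : ζ * ζ' = 1 := by rw [hζ', ← conj_eq_pow hζ, mul_conj_eq_one hζ]
  have hσζ : σc ζ = ζ' := conj_eq_pow hζ
  have hσζ' : σc ζ' = ζ := by rw [← hσζ, conj_conj]
  have hFζ' : F ζ' = ζ' ^ q := by rw [hζ', map_pow, hF, ← pow_mul, ← pow_mul, mul_comm]
  set A : 𝓞 K := x + ζ * y with hA
  set B : 𝓞 K := x + ζ' * y with hB
  set A' : 𝓞 K := x + ζ ^ q * y with hA'
  set B' : 𝓞 K := x + ζ' ^ q * y with hB'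
  have hσA : σc A = B := by simp [hA, hB, hσζ]
  have hσB : σc B = A := by simp [hA, hB, hσζ']
  have hσA' : σc A' = B' := by simp [hA', hB', hσζ]
  have hσB' : σc B' = A' := by simp [hA', hB', hσζ']
  have hFA : F A = A' := by simp [hA, hA', hF]
  have hFB : F B = B' := by simp [hB, hB', hFζ']
  have hqE : (q : 𝓞 K) * E = B ^ q * A' - B' * A ^ q := by
    rw [hB, hA', hB', hA, add_mul_pow_mul_sub_eq_sum _ _ _ _ hζζ', hE, Finset.mul_sum]
    refine Finset.sum_congr rfl fun j hj ↦ ?_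
    rw [Finset.mem_Icc] at hj
    have := congrArg (Int.cast : ℤ → 𝓞 K) (he j hj.1 hj.2)
    push_cast at this
    rw [← mul_assoc, this]
  have hσE : σc E = -E := by
    refine mul_left_cancel₀ hq0 ?_
    have := congrArg σc hqE
    simp only [map_mul, map_sub, map_pow, map_natCast, hσA, hσB, hσA', hσB'] at this
    linear_combination this + hqE
  rw [hσA] at hμ
  -- the congruence modulo `q ^ 2`, before cancelling the power of `B'`
  have h1 : (q : 𝓞 K) ∣ B' ^ (q - 1) * E := by
    have h2 : (q : 𝓞 K) ∣ B * F μ - B' * A := by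
      have e1 := prime_dvd_pow_sub_map hζ hq F hF μ
      have e2 := prime_dvd_pow_sub_map hζ hq F hF B
      rw [hFB] at e2
      have e3 : B * F μ - B' * A = (B ^ q - B') * A - (μ ^ q - F μ) * B := by
        rw [hμ]
        obtain ⟨n, rfl⟩ : ∃ n, q = n + 1 := ⟨q - 1, by have := hq.one_le; lia⟩
        rw [Nat.add_sub_cancel]
        ring
      rw [e3]
      exact dvd_sub (e2.mul_right _) (e1.mul_right _)
    have h3 := dvd_sub_pow_of_dvd_sub h2 1
    rw [pow_one] at h3
    have h4 : F μ ^ q = B' ^ (q - 1) * A' := by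
      rw [← map_pow, hμ, map_mul, map_pow, hFA, hFB]
    have h5 : (B * F μ) ^ q - (B' * A) ^ q = (q : 𝓞 K) * (B' ^ (q - 1) * E) := by
      rw [mul_pow, h4, mul_pow, mul_left_comm (q : 𝓞 K), hqE]
      have : B' ^ q = B' ^ (q - 1) * B' := by
        rw [← pow_succ, Nat.sub_add_cancel hq.one_le]
      rw [this]
      ring
    rw [h5, pow_succ, pow_one] at h3
    exact (mul_dvd_mul_iff_left hq0).1 h3
  have h2 : (q : 𝓞 K) ∣ A' ^ (q - 1) * E := by
    obtain ⟨w, hw⟩ := h1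
    have := congrArg σc hw
    simp only [map_mul, map_pow, map_natCast, hσB', hσE] at this
    exact ⟨-σc w, by linear_combination -this⟩
  -- `A'`, `B'` and `q` have no common prime divisor, whence `E ≡ 0` modulo `q`
  let J : Ideal (𝓞 K) :=
    Submodule.comap (LinearMap.toSpanSingleton (𝓞 K) (𝓞 K) E) (Ideal.span {(q : 𝓞 K)})
  have hJ : ∀ t, t ∈ J ↔ (q : 𝓞 K) ∣ t * E := by
    intro t
    rw [Submodule.mem_comap, LinearMap.toSpanSingleton_apply, smul_eq_mul, Ideal.mem_span_singleton]
  suffices (1 : 𝓞 K) ∈ J by simpa [hJ] using this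
  rw [← Ideal.eq_top_iff_one]
  by_contra hne
  obtain ⟨P, hP, hJP⟩ := Ideal.exists_le_maximal J hne
  have hAP : A' ∈ P := hP.isPrime.mem_of_pow_mem _ (hJP ((hJ _).2 h2))
  have hBP : B' ∈ P := hP.isPrime.mem_of_pow_mem _ (hJP ((hJ _).2 h1))
  have hqP : ((q : ℤ) : 𝓞 K) ∈ P := hJP ((hJ _).2 (by simp))
  have hmem : ∀ η : 𝓞 K, η ^ p = 1 → η ^ q ∈ Polynomial.nthRootsFinset p (1 : 𝓞 K) := by
    intro η hη
    rw [Polynomial.mem_nthRootsFinset hp.pos, ← pow_mul, mul_comm, pow_mul, hη, one_pow]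
  have hζ'p : ζ' ^ p = 1 := by rw [hζ', ← pow_mul, mul_comm, pow_mul, hζ.pow_eq_one, one_pow]
  have hneq : ζ ^ q ≠ ζ' ^ q := by
    intro heq
    have h6 : ζ ^ (q * 2) = 1 := by
      rw [pow_mul, sq]
      nth_rw 2 [heq]
      rw [← mul_pow, hζζ', one_pow]
    have h7 := (hζ.pow_eq_one_iff_dvd _).1 h6
    rcases hp.dvd_mul.1 h7 with h8 | h8
    · exact hpq ((Nat.prime_dvd_prime_iff_eq hp hq).1 h8)
    · exact hp2 ((Nat.prime_dvd_prime_iff_eq hp Nat.prime_two).1 h8)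
  have hπ := zeta_sub_one_mem_of_add_mul_mem hζ hxy (hmem ζ hζ.pow_eq_one) (hmem ζ' hζ'p) hneq
    hAP hBP
  refine hP.ne_top ((Ideal.eq_top_iff_one P).2 (one_mem_of_zeta_sub_one_mem hζ hπ ?_ hqP))
  intro h9
  have h10 : p ∣ q := by exact_mod_cast h9
  exact hpq ((Nat.prime_dvd_prime_iff_eq hp hq).1 h10)

end Local

/-! ### Kummer's congruence for equal exponents -/

section Kummer

variable {p : ℕ} [Fact p.Prime] {K : Type*} [Field K] [NumberField K]
  [IsCyclotomicExtension {p} ℚ K] {ζ : 𝓞 K}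

theorem exists_intCast_prime_dvd_pow_sub (hζ : IsPrimitiveRoot ζ p) (a : 𝓞 K) :
    ∃ n : ℤ, (p : 𝓞 K) ∣ a ^ p - n := by
  obtain ⟨f, rfl⟩ := exists_aeval_eq hζ a
  refine ⟨f.eval 1, ?_⟩
  have := prime_dvd_aeval_pow_sub (Fact.out : p.Prime) ζ f
  rwa [hζ.pow_eq_one, ← map_one (algebraMap ℤ (𝓞 K)), Polynomial.aeval_algebraMap_apply,
    Polynomial.coe_aeval_eq_eval, algebraMap_int_eq, eq_intCast] at this

variable [IsCMField K]

local notation "σc" => IsCMField.ringOfIntegersComplexConj K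

/-- Kummer's argument for exponent `p`: modulo `p` every `p`-th power is a rational integer, so the
relation between `x + ζ y` and its conjugate becomes a linear relation between at most four roots of
unity. -/
theorem prime_dvd_sub_of_pow_add_pow_eq_pow_self {x y z : ℤ} (hp5 : 5 ≤ p)
    (hζ : IsPrimitiveRoot ζ p) (hclass : ¬ p ∣ relativeClassNumber K) (hxy : IsCoprime x y)
    (h : x ^ p + y ^ p = z ^ p)
    (hx : ¬ (p : ℤ) ∣ x) (hy : ¬ (p : ℤ) ∣ y) (hz : ¬ (p : ℤ) ∣ z) : (p : ℤ) ∣ x - y := by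
  have hp : p.Prime := Fact.out
  have hpi : Prime (p : ℤ) := Nat.prime_iff_prime_int.1 hp
  have hp2 : p ≠ 2 := by lia
  have hz0 : z ≠ 0 := by rintro rfl; exact hz (dvd_zero _)
  have hs : ¬ (p : ℤ) ∣ x + y := by
    intro hd
    refine hz (hpi.dvd_of_dvd_pow (n := p) ?_)
    rw [← h]
    exact hd.trans ((hp.odd_of_ne_two hp2).add_dvd_pow_add_pow x y)
  obtain ⟨a, ha, r, hr⟩ := exists_add_zeta_mul_pow_eq hp2 hζ hp hclass hxy hz0 h
  obtain ⟨μ, hμ⟩ := exists_mul_pow_eq_conj_pow_mul hp.one_le ha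
    ((hζ.isUnit hp.ne_zero).neg.pow r) hr
  obtain ⟨n, hn⟩ := exists_intCast_prime_dvd_pow_sub hζ μ
  set ζ' : 𝓞 K := ζ ^ (p - 1) with hζ'
  have hσ : σc ((x : 𝓞 K) + ζ * y) = x + ζ' * y := by simp [conj_eq_pow hζ, hζ']
  rw [hσ] at hμ
  set A : 𝓞 K := x + ζ * y with hA
  set B : 𝓞 K := x + ζ' * y with hB
  have hBp : (p : 𝓞 K) ∣ B ^ p - ((x + y : ℤ) : 𝓞 K) := by
    have := prime_dvd_aeval_pow_sub hp ζ' (Polynomial.C x + Polynomial.X * Polynomial.C y)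
    have h1 : ζ' ^ p = 1 := by rw [hζ', ← pow_mul, mul_comm, pow_mul, hζ.pow_eq_one, one_pow]
    rw [h1] at this
    simpa [hB] using this
  obtain ⟨ε, hε⟩ : ∃ ε : ℤ, (-1 : 𝓞 K) ^ r = ε := ⟨(-1) ^ r, by push_cast; rfl⟩
  set s : ℤ := x + y with hsdef
  have h1 : (p : 𝓞 K) ∣ s * A - (n * ε : ℤ) * ζ ^ r * B := by
    have h2 : (s : 𝓞 K) * A - (n * ε : ℤ) * ζ ^ r * B =
        (-ζ) ^ r * B * (μ ^ p - n) - (B ^ p - s) * A := by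
      have h3 : B ^ p = B ^ (p - 1) * B := by rw [← pow_succ, Nat.sub_add_cancel hp.one_le]
      have h4 : (-ζ) ^ r = ε * ζ ^ r := by rw [neg_pow, hε]
      rw [h3]
      rw [h4] at hμ ⊢
      push_cast
      linear_combination -B * hμ
    rw [h2]
    exact dvd_sub (hn.mul_left _) (hBp.mul_right _)
  have hζ1 : ∀ k : ℕ, ζ - 1 ∣ ζ ^ k - 1 := fun k ↦ by simpa using sub_dvd_pow_sub_pow ζ 1 k
  -- reduction modulo `ζ - 1` determines the integer factor
  have hns : (p : ℤ) ∣ s - n * ε := by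
    have h2 : (p : ℤ) ∣ (s - n * ε) * s := by
      refine dvd_of_zeta_sub_one_dvd_intCast hζ ?_
      obtain ⟨w1, hw1⟩ := (zeta_sub_one_dvd_prime hζ).trans h1
      obtain ⟨w2, hw2⟩ := hζ1 r
      obtain ⟨w3, hw3⟩ := hζ1 (p - 1)
      refine ⟨w1 - s * y + (n * ε : ℤ) * ζ ^ r * w3 * y + (n * ε : ℤ) * s * w2, ?_⟩
      have hs' : (s : 𝓞 K) = x + y := by rw [hsdef]; push_cast; rfl
      rw [← hζ'] at hw3
      rw [hA, hB, hs'] at hw1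
      push_cast at hw1 ⊢
      rw [hs']
      linear_combination hw1 + (n * ε * ζ ^ r * y : 𝓞 K) * hw3 + (n * ε * (x + y) : 𝓞 K) * hw2
    exact (hpi.dvd_or_dvd h2).resolve_right hs
  have h5 : (p : 𝓞 K) ∣ ∑ i : Fin 4, ((![s * x, s * y, -(s * x), -(s * y)] i : ℤ) : 𝓞 K) *
      ζ ^ ((![0, 1, r, r + (p - 1)] i : ℕ)) := by
    have h6 : (p : 𝓞 K) ∣ ((s - n * ε : ℤ) : 𝓞 K) := by
      simpa using (Int.castRingHom (𝓞 K)).map_dvd hns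
    have h7 := dvd_sub h1 (h6.mul_right (ζ ^ r * B))
    convert h7 using 1
    rw [Fin.sum_univ_four]
    simp only [Matrix.cons_val]
    rw [hA, hB, hζ']
    push_cast
    ring
  have hclassSum := class_sums_modEq_of_dvd_sum hζ Finset.univ _ _ p h5
  set ρ : ZMod p := (r : ZMod p) with hρ
  have hsum : ∀ m : ZMod p,
      ∑ i : Fin 4 with (((![0, 1, r, r + (p - 1)] i : ℕ)) : ZMod p) = m,
        (![s * x, s * y, -(s * x), -(s * y)] i : ℤ) =
      s * ((if 0 = m then x else 0) + (if 1 = m then y else 0) - (if ρ = m then x else 0) -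
        (if ρ - 1 = m then y else 0)) := by
    intro m
    have hc : ((r + (p - 1) : ℕ) : ZMod p) = ρ - 1 := by
      rw [Nat.cast_add, Nat.cast_sub hp.one_le]
      simp [hρ, sub_eq_add_neg]
    rw [Finset.sum_filter, Fin.sum_univ_four]
    simp only [Matrix.cons_val, hc, ← hρ, Nat.cast_zero, Nat.cast_one]
    split_ifs <;> ring
  -- as `p ≥ 5`, some residue class contains none of the four exponents
  obtain ⟨m₀, hm₀⟩ : ∃ m₀ : ZMod p, m₀ ∉ ({0, 1, ρ, ρ - 1} : Finset (ZMod p)) := by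
    by_contra! hall
    have h8 : (Finset.univ : Finset (ZMod p)).card ≤ ({0, 1, ρ, ρ - 1} : Finset (ZMod p)).card :=
      Finset.card_le_card fun m _ ↦ hall m
    rw [Finset.card_univ, ZMod.card] at h8
    have := Finset.card_le_four (a := (0 : ZMod p)) (b := 1) (c := ρ) (d := ρ - 1)
    lia
  simp only [Finset.mem_insert, Finset.mem_singleton, not_or] at hm₀
  have hzero : ∀ m : ZMod p, (p : ℤ) ∣ (if 0 = m then x else 0) + (if 1 = m then y else 0) -
      (if ρ = m then x else 0) - (if ρ - 1 = m then y else 0) := by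
    intro m
    have h9 := hclassSum m m₀
    rw [hsum, hsum, if_neg (Ne.symm hm₀.1), if_neg (Ne.symm hm₀.2.1), if_neg (Ne.symm hm₀.2.2.1),
      if_neg (Ne.symm hm₀.2.2.2)] at h9
    have h10 := (Int.modEq_iff_dvd.1 h9.symm)
    simp only [add_zero, sub_zero, mul_zero] at h10
    exact (hpi.dvd_or_dvd h10).resolve_left hs
  have hcharne : ∀ k : ℕ, 0 < k → k < p → (k : ZMod p) ≠ 0 := fun k h0 h1 ↦ by
    rw [Ne, ZMod.natCast_eq_zero_iff]
    exact Nat.not_dvd_of_pos_of_lt h0 h1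
  have hone : (1 : ZMod p) ≠ 0 := one_ne_zero
  have htwo : (2 : ZMod p) ≠ 0 := by exact_mod_cast hcharne 2 (by lia) (by lia)
  by_cases h1ρ : ρ = 1
  · simpa [h1ρ] using hzero 0
  exfalso
  by_cases h0ρ : ρ = 0
  · have h11 := hzero 1
    rw [if_neg hone.symm, if_pos rfl, h0ρ, if_neg hone.symm, if_neg] at h11
    · exact hy (by simpa using h11)
    · intro h12
      exact htwo (by linear_combination -h12)
  · have h11 := hzero 0
    rw [if_pos rfl, if_neg hone, if_neg h0ρ, if_neg (sub_ne_zero.2 h1ρ)] at h11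
    exact hx (by simpa using h11)

end Kummer

end

/-! ### Equal exponents -/

/-- When `p` does not divide `w`, the factor `u - v` of `u ^ p - v ^ p` is prime to its cofactor. -/
theorem exists_sub_eq_pow {p : ℕ} (hp : p.Prime) (hp2 : p ≠ 2) {u v w : ℤ} (huv : IsCoprime u v)
    (h : u ^ p - v ^ p = w ^ p) (hw : ¬ (p : ℤ) ∣ w) : ∃ c : ℤ, u - v = c ^ p := by
  have hpi : Prime (p : ℤ) := Nat.prime_iff_prime_int.1 hp
  have hpw : ¬ (p : ℤ) ∣ u - v := fun hd ↦ hw (hpi.dvd_of_dvd_pow (n := p) (by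
    rw [← h]; exact hd.trans (sub_dvd_pow_sub_pow u v p)))
  refine Int.eq_pow_of_mul_eq_pow_odd_right (b := u - v) ?_ (hp.odd_of_ne_two hp2)
    ((Commute.all u v).geom_sum₂_mul p |>.trans h)
  refine isCoprime_of_prime_dvd (fun h0 ↦ hpw (h0.2 ▸ dvd_zero _)) fun ℓ hℓ h1 h2 ↦ ?_
  rw [dvd_geom_sum₂_iff_of_dvd_sub h2] at h1
  rcases hℓ.dvd_or_dvd h1 with h3 | h3
  · exact hpw (((hℓ.associated_of_dvd hpi h3).symm.dvd).trans h2)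
  · have h4 := hℓ.dvd_of_dvd_pow h3
    exact hℓ.not_isUnit (huv.isUnit_of_dvd' ((dvd_sub_left h4).1 h2) h4)

theorem sq_dvd_sub_of_dvd_pow {p : ℕ} (hp : p.Prime) (hp3 : 3 ≤ p) {u v w : ℤ}
    (h : u ^ p - v ^ p = w ^ p) (hu : ¬ (p : ℤ) ∣ u) (hw : (p : ℤ) ∣ w) :
    (p : ℤ) ^ 2 ∣ u - v := by
  have : Fact p.Prime := ⟨hp⟩
  have h1 : (p : ℤ) ∣ u - v := by
    rw [← ZMod.intCast_zmod_eq_zero_iff_dvd] at hw ⊢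
    have h2 := congrArg (Int.cast : ℤ → ZMod p) h
    push_cast at h2 ⊢
    rwa [ZMod.pow_card, ZMod.pow_card, ZMod.pow_card, hw] at h2
  have h3 := Int.emultiplicity_pow_sub_pow hp (hp.odd_of_ne_two (by lia)) h1 hu p
  rw [h, hp.emultiplicity_self] at h3
  have h4 : (p : ℤ) ^ 3 ∣ w ^ p := (pow_dvd_pow _ hp3).trans (pow_dvd_pow_of_dvd hw p)
  rw [pow_dvd_iff_le_emultiplicity, h3] at h4
  rw [pow_dvd_iff_le_emultiplicity]
  have h5 : ((2 : ℕ) : ℕ∞) + 1 ≤ emultiplicity (p : ℤ) (u - v) + 1 := by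
    refine le_trans (le_of_eq ?_) h4
    norm_num
  exact (ENat.add_le_add_iff_right ENat.one_ne_top).1 h5

theorem sq_dvd_of_dvd_of_pow_add_pow_eq {p : ℕ} (hp : p.Prime) (hp3 : 3 ≤ p) {x y z : ℤ}
    (hxy : IsCoprime x y) (h : x ^ p + y ^ p = z ^ p) (hx : (p : ℤ) ∣ x) : (p : ℤ) ^ 2 ∣ x := by
  have : Fact p.Prime := ⟨hp⟩
  have hodd := hp.odd_of_ne_two (show p ≠ 2 by lia)
  have hpi : Prime (p : ℤ) := Nat.prime_iff_prime_int.1 hp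
  have hpy : ¬ (p : ℤ) ∣ y := fun hy ↦ hpi.not_isUnit (hxy.isUnit_of_dvd' hx hy)
  have hpz : ¬ (p : ℤ) ∣ z := fun hz ↦ hpy (hpi.dvd_of_dvd_pow (n := p)
    ((dvd_add_right (dvd_pow hx hp.ne_zero)).1 (h ▸ dvd_pow hz hp.ne_zero)))
  have hzx : IsCoprime z x := by
    rw [← IsCoprime.pow_left_iff hp.pos, ← h, isCoprime_comm]
    have h1 : IsCoprime x (y ^ p) := hxy.pow_right
    obtain ⟨n, hn⟩ : ∃ n, p = n + 1 := ⟨p - 1, by lia⟩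
    have := h1.add_mul_left_right (x ^ n)
    rwa [← pow_succ', ← hn, add_comm] at this
  have h1 : (p : ℤ) ^ 2 ∣ z - y := sq_dvd_sub_of_dvd_pow hp hp3 (w := x) (by rw [← h]; ring) hpz hx
  obtain ⟨c, hc⟩ := exists_sub_eq_pow hp (by lia) hxy.neg_right (w := z)
    (by rw [hodd.neg_pow, sub_neg_eq_add, h]) hpz
  obtain ⟨b, hb⟩ := exists_sub_eq_pow hp (by lia) hzx (w := y) (by rw [← h]; ring) hpy
  -- `c ^ p = x + y` and `b ^ p = z - x` agree modulo `p`, hence modulo `p ^ 2`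
  have h2 : c ^ p - b ^ p = 2 * x - (z - y) := by rw [← hc, ← hb]; ring
  have h3 : (p : ℤ) ∣ c - b := by
    have h4 : (p : ℤ) ∣ c ^ p - b ^ p := by
      rw [h2]
      exact dvd_sub (hx.mul_left 2) ((dvd_pow_self _ two_ne_zero).trans h1)
    rw [← ZMod.intCast_zmod_eq_zero_iff_dvd] at h4 ⊢
    push_cast at h4 ⊢
    rwa [ZMod.pow_card, ZMod.pow_card] at h4
  have h4 := dvd_sub_pow_of_dvd_sub h3 1
  rw [pow_one, h2] at h4
  have h5 : (p : ℤ) ^ 2 ∣ 2 * x := (dvd_sub_left h1).1 h4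
  refine (IsCoprime.pow_left ?_).dvd_of_dvd_mul_left h5
  exact_mod_cast (Nat.coprime_primes hp Nat.prime_two).2 (show p ≠ 2 by lia)

/-- Equal exponents. When `p` divides one of `x`, `y`, `z` the claim is elementary; otherwise
Kummer's congruence, applied to the two ways of writing the equation, gives `3 x ≡ 0` modulo `p`. -/
theorem sq_dvd_of_pow_add_pow_eq_pow_self {p : ℕ} [Fact p.Prime] (hp5 : 5 ≤ p)
    (hclass : ¬ p ∣ relativeClassNumber (CyclotomicField p ℚ)) {x y z : ℤ} (hxy : IsCoprime x y)
    (h : x ^ p + y ^ p = z ^ p) :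
    (p : ℤ) ^ 2 ∣ x ∨ (p : ℤ) ^ 2 ∣ y ∨ (p : ℤ) ^ 2 ∣ x + y ∨ (p : ℤ) ^ 2 ∣ x - y := by
  have hp : p.Prime := Fact.out
  have hodd := hp.odd_of_ne_two (show p ≠ 2 by lia)
  have hpi : Prime (p : ℤ) := Nat.prime_iff_prime_int.1 hp
  by_cases hx : (p : ℤ) ∣ x
  · exact Or.inl (sq_dvd_of_dvd_of_pow_add_pow_eq hp (by lia) hxy h hx)
  by_cases hy : (p : ℤ) ∣ y
  · exact Or.inr (Or.inl (sq_dvd_of_dvd_of_pow_add_pow_eq hp (by lia) hxy.symm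
      (by rw [add_comm, h]) hy))
  by_cases hz : (p : ℤ) ∣ z
  · refine Or.inr (Or.inr (Or.inl ?_))
    have := sq_dvd_sub_of_dvd_pow hp (by lia) (u := x) (v := -y) (w := z)
      (by rw [hodd.neg_pow, sub_neg_eq_add, h]) hx hz
    rwa [sub_neg_eq_add] at this
  exfalso
  have : NeZero p := ⟨hp.ne_zero⟩
  have : IsCyclotomicExtension {p} ℚ (CyclotomicField p ℚ) :=
    CyclotomicField.isCyclotomicExtension p ℚ
  have := isCMField_of_cyclotomic (p := p) (CyclotomicField p ℚ) (by lia)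
  have hζ := (IsCyclotomicExtension.zeta_spec p ℚ (CyclotomicField p ℚ)).toInteger_isPrimitiveRoot
  have hxz : IsCoprime x (-z) := by
    rw [IsCoprime.neg_right_iff, ← IsCoprime.pow_right_iff hp.pos, ← h]
    obtain ⟨n, hn⟩ : ∃ n, p = n + 1 := ⟨p - 1, by lia⟩
    have := (hxy.pow_right (n := p)).add_mul_left_right (x ^ n)
    rwa [← pow_succ', ← hn, add_comm] at this
  have h1 := prime_dvd_sub_of_pow_add_pow_eq_pow_self hp5 hζ hclass hxy h hx hy hz
  have h2 := prime_dvd_sub_of_pow_add_pow_eq_pow_self hp5 hζ hclass hxz (z := -y)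
    (by rw [hodd.neg_pow, hodd.neg_pow, ← h]; ring) hx (by rwa [dvd_neg]) (by rwa [dvd_neg])
  have h3 : ((3 * x : ℤ) : ZMod p) = 0 := by
    have h4 := congrArg (Int.cast : ℤ → ZMod p) h
    rw [← ZMod.intCast_zmod_eq_zero_iff_dvd] at h1 h2
    push_cast at h1 h2 h4 ⊢
    rw [ZMod.pow_card, ZMod.pow_card, ZMod.pow_card] at h4
    linear_combination h4 + h1 + h2
  rw [ZMod.intCast_zmod_eq_zero_iff_dvd] at h3
  rcases hpi.dvd_or_dvd h3 with h4 | h4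
  · have h5 : p ∣ 3 := by exact_mod_cast h4
    exact absurd (Nat.le_of_dvd (by lia) h5) (by lia)
  · exact hx h4

/-! ### The general case -/

theorem mainTheorem4 (p q : ℕ) [Fact p.Prime] (hp2 : p ≠ 2) (hq : q.Prime) (hq2 : q ≠ 2)
    (hmax : (q : ℝ) < max (p : ℝ) ((p : ℝ) * ((p : ℝ) - 20) / 16))
    (hclass : ¬ q ∣ relativeClassNumber (CyclotomicField p ℚ))
    (x y z : ℤ) (hcop : Int.gcd (Int.gcd x y : ℤ) z = 1)
    (heq : x ^ p + y ^ p = z ^ q) :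
    ∃ f : ℤ, (f = -1 ∨ f = 0 ∨ f = 1) ∧
      (x + f * y ≡ 0 [ZMOD (q : ℤ) ^ 2] ∨ y + f * x ≡ 0 [ZMOD (q : ℤ) ^ 2]) := by
  have hp : p.Prime := Fact.out
  have hodd := hp.odd_of_ne_two hp2
  suffices hdvd : (q : ℤ) ^ 2 ∣ x ∨ (q : ℤ) ^ 2 ∣ y ∨ (q : ℤ) ^ 2 ∣ x + y ∨
      (q : ℤ) ^ 2 ∣ x - y by
    simp only [Int.modEq_zero_iff_dvd]
    rcases hdvd with h | h | h | h
    · exact ⟨0, by simp, Or.inl (by simpa using h)⟩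
    · exact ⟨0, by simp, Or.inr (by simpa using h)⟩
    · exact ⟨1, by simp, Or.inl (by simpa using h)⟩
    · exact ⟨-1, by simp, Or.inl (by simpa [sub_eq_add_neg] using h)⟩
  have hb : q < p ∨ 16 * q + 20 * p < p * p := by
    rcases lt_max_iff.1 hmax with h | h
    · exact Or.inl (by exact_mod_cast h)
    · right
      have : (16 * q + 20 * p : ℝ) < p * p := by linarith
      exact_mod_cast this
  have hxy : IsCoprime x y := by
    rw [Int.isCoprime_iff_gcd_eq_one]
    by_contra hne
    obtain ⟨ℓ, hℓ, hd⟩ := Nat.exists_prime_and_dvd hne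
    have hd' : (ℓ : ℤ) ∣ (Int.gcd x y : ℤ) := Int.natCast_dvd_natCast.2 hd
    have hz : (ℓ : ℤ) ∣ z := by
      refine (Nat.prime_iff_prime_int.1 hℓ).dvd_of_dvd_pow (n := q) ?_
      rw [← heq]
      exact dvd_add (dvd_pow (hd'.trans (Int.gcd_dvd_left x y)) hp.ne_zero)
        (dvd_pow (hd'.trans (Int.gcd_dvd_right x y)) hp.ne_zero)
    have h1 := Int.dvd_coe_gcd hd' hz
    rw [hcop] at h1
    exact hℓ.one_lt.ne' (Nat.dvd_one.1 (by exact_mod_cast h1))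
  by_cases hpq : p = q
  · subst hpq
    refine sq_dvd_of_pow_add_pow_eq_pow_self ?_ hclass hxy heq
    have := hp.pos
    rcases hb with h | h
    · exact absurd h (lt_irrefl p)
    · by_contra! h5
      nlinarith
  by_cases hz : z = 0
  · rw [hz, zero_pow hq.ne_zero, ← sub_neg_eq_add, ← hodd.neg_pow, sub_eq_zero] at heq
    have h1 : x = -y := hodd.strictMono_pow.injective heq
    exact Or.inr (Or.inr (Or.inl (by rw [h1]; simp)))
  have : NeZero p := ⟨hp.ne_zero⟩
  have : IsCyclotomicExtension {p} ℚ (CyclotomicField p ℚ) :=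
    CyclotomicField.isCyclotomicExtension p ℚ
  have := isCMField_of_cyclotomic (p := p) (CyclotomicField p ℚ) hp2
  have hζ := (IsCyclotomicExtension.zeta_spec p ℚ (CyclotomicField p ℚ)).toInteger_isPrimitiveRoot
  obtain ⟨e, he⟩ := exists_choose_mul_sub_div q hq x y
  obtain ⟨h1, h2⟩ := sq_dvd_of_class_sums hp hq hp2 hq2 hpq hb he
    (class_sums_modEq_neg hp2 hq hq2 hpq hζ hclass hxy hz heq he)
  exact sq_dvd_of_sq_dvd_pow_mul_sub hq hq2 hxy h1 h2
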